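/- **Conventions.** For a symmetric matrix $H\in\mathbb R^{n\times n}$ let $\lambda_1(H)\ge\dots\ge\lambda_n(H)$ be its eigenvalues, $\kappa_2(H)=\lambda_1(H)/\lambda_n(H)$, and $\kappa_2^S(H)=\kappa_2(DHD)$ with $D=\operatorname{diag}(h_{ii}^{-1/2})$. Floating-point arithmetic of precision $u$ (without underflow and overflow) is given by a rounding map $\mathrm{fl}$ with $|\mathrm{fl}(x)-x|\le u|x|$ for all real $x$, each operation $+,-,\times,/,\sqrt{\ }$ returning the rounded exact result. Let $0<u_h<u<0.1$ and $nu<1/2$, let $\mathrm{fl}$ and $\mathrm{fl}_h$ be rounding maps of precision $u$ and $u_h$, and put $\gamma_h=nu_h/(1-nu_h)$. **Algorithm.** Given $A$ and $\widetilde Q$ in $\mathbb R^{n\times n}$, put $\widetilde A=\widetilde Q^TA\widetilde Q$. (1) Evaluate $(\widetilde Q^TA)\widetilde Q$ in precision $u_h$ (inner products summed in any order), round the result entrywise to precision $u$, and replace it by its symmetric part computed in precision $u$ (if it is already symmetric, it may be kept as it is). This gives $\widetilde A_{\mathrm{comp}}$. (2) In precision $u$, apply a finite sequence of $M\ge 0$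 Jacobi rotations to $H_0=\widetilde A_{\mathrm{comp}}$, giving $H_0,H_1,\dots,H_M$, with pivots $i\ne j$ in any order. Nothing is done when $h_{ij}=0$; otherwise, with $\zeta=(h_{jj}-h_{ii})/(2h_{ij})$, $t=\operatorname{sign}(\zeta)/(|\zeta|+\sqrt{1+\zeta^2})$ (where $\operatorname{sign}(0)=1$), $cs=1/\sqrt{1+t^2}$, $sn=cs\cdot t$, one sets $h_{ii}\leftarrow h_{ii}-h_{ij}t$, $h_{jj}\leftarrow h_{jj}+h_{ij}t$, $h_{ij},h_{ji}\leftarrow0$, and $h_{ik},h_{ki}\leftarrow cs\,h_{ik}-sn\,h_{jk}$, $h_{jk},h_{kj}\leftarrow sn\,h_{ik}+cs\,h_{jk}$ for $k\ne i,j$ (old values on the right). The run ends with a matrix $H_M$ satisfying $|h_{ij}|\le \mathrm{tol}\sqrt{h_{ii}h_{jj}}$ for all $i\ne j$, where $\mathrm{tol}>0$. The computed eigenvalues $\widehat\lambda_1\ge\dots\ge\widehat\lambda_n$ are the sorted diagonal entries of $H_M$. Let $c,S,g$ be such that $\mathrm{tol}\le cu$, the run takes at most $S\in\mathbb N$ sweeps,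 i.e. $M\le S\,n(n-1)/2$, and $g\ge1$ with $\kappa_2^S(H_m)\le g\,\kappa_2^S(H_0)$ for $0\le m<M$. **Theorem.** There is a polynomial $q$ of degree at most $2$ (an absolute one, depending on nothing) such that, with $p_3(n)=(1+c+Sg)\,q(n)$, the following holds in the situation above. Let $A\in\mathbb R^{n\times n}$ be symmetric positive definite, and let $p_1$ be a real number with $\|\widetilde Q^T\widetilde Q-I\|_2\le p_1u<1$. Suppose that - (A1) $10n^{3/2}u(1-p_1u)^{-1}\kappa_2(A)<1$, - (A2) $\gamma_h<\dfrac{u(1-p_1u)}{16n^{1/2}\kappa_2(A)}$, - (A3) $14nu\,\kappa_2^S(\widetilde A)<1$. If $p_3(n)\,\kappa_2^S(\widetilde A)\,u<1$, then for all $k=1,\dots,n$ $$\frac{|\widehat\lambda_k-\lambda_k(A)|}{\lambda_k(A)}\le p_3(n)\,\kappa_2^S(\widetilde A)\,u+p_1u .$$ -/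

import Mathlib

open Polynomial

noncomputable section

namespace MixedJacobi

/-! ### Eigenvalues, norms and condition numbers -/

/-- `lam A k` is the `k`-th largest eigenvalue of the real symmetric matrix `A`
(`k = 0` is the largest one); it is `0` by convention if `A` is not symmetric. -/
def lam {n : ℕ} (A : Matrix (Fin n) (Fin n) ℝ) (k : Fin n) : ℝ :=
  open Classical in
  if h : A.IsHermitian then h.eigenvalues₀ (Fin.cast (Fintype.card_fin n).symm k) else 0

/-- The spectral norm (operator norm for the Euclidean norm). -/
def norm2 {n : ℕ} (A : Matrix (Fin n) (Fin n) ℝ) : ℝ :=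
  ‖Matrix.toEuclideanCLM (n := Fin n) (𝕜 := ℝ) A‖

/-- The condition number `κ₂(A) = λ₁(A) / λₙ(A)`. -/
def cond2 {n : ℕ} (A : Matrix (Fin n) (Fin n) ℝ) : ℝ :=
  if h : 0 < n then lam A ⟨0, h⟩ / lam A ⟨n - 1, Nat.sub_lt h one_pos⟩ else 0

/-- The scaled condition number `κ₂(D A D)`, where `D = diag (aᵢᵢ ^ (-1/2))`. -/
def scaledCond {n : ℕ} (A : Matrix (Fin n) (Fin n) ℝ) : ℝ :=
  cond2 (Matrix.diagonal (fun i => (Real.sqrt (A i i))⁻¹) * A *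
    Matrix.diagonal (fun i => (Real.sqrt (A i i))⁻¹))

/-- `γ = n u / (1 - n u)`. -/
def gam (n : ℕ) (u : ℝ) : ℝ := n * u / (1 - n * u)

/-- The `k`-th largest component of a vector (`k = 0` is the largest one). -/
def kthLargest {n : ℕ} (v : Fin n → ℝ) (k : Fin n) : ℝ :=
  v (Tuple.sort (fun i => -v i) k)

/-! ### Floating-point arithmetic

An arithmetic of precision `u` without underflow and overflow is given by its rounding map `fl`;
every operation `+, -, *, /, √` returns the rounded exact result. -/

/-- The standard model: `fl x = x (1 + δ)` with `|δ| ≤ u`. -/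
def IsRounding (u : ℝ) (fl : ℝ → ℝ) : Prop :=
  ∀ x : ℝ, |fl x - x| ≤ u * |x|

/-- `FlSum fl s x`: the number `x` is the floating-point sum of the terms `s`, for some order
of summation. -/
inductive FlSum (fl : ℝ → ℝ) : Multiset ℝ → ℝ → Prop
  | single (a : ℝ) : FlSum fl {a} a
  | add (s t : Multiset ℝ) (x y : ℝ) (hs : FlSum fl s x) (ht : FlSum fl t y) :
      FlSum fl (s + t) (fl (x + y))

/-- `C` is a computed matrix product `A * B`: every entry is the floating-point sum, in some
order, of the rounded products. -/
def IsFlMul {n : ℕ} (fl : ℝ → ℝ) (A B C : Matrix (Fin n) (Fin n) ℝ) : Prop :=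
  ∀ i j, FlSum fl ((Finset.univ : Finset (Fin n)).val.map (fun k => fl (A i k * B k j))) (C i j)

/-- The symmetric part `(B + Bᵀ) / 2`, computed in floating point. -/
def flSymPart {n : ℕ} (fl : ℝ → ℝ) (B : Matrix (Fin n) (Fin n) ℝ) :
    Matrix (Fin n) (Fin n) ℝ :=
  Matrix.of fun i j => fl (fl (B i j + B j i) / 2)

/-- `Acomp` is a computed preconditioned matrix: the product `Qᵀ A Q` is evaluated as
`(Qᵀ A) Q` entirely in the high-precision arithmetic `flh`, then demoted (rounded entrywise)
by `fl`, and the result is replaced by its computed symmetric part, unless it is already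
symmetric and is kept as it is. -/
def IsComputedPrecond {n : ℕ} (fl flh : ℝ → ℝ) (A Q Acomp : Matrix (Fin n) (Fin n) ℝ) : Prop :=
  ∃ P Ah : Matrix (Fin n) (Fin n) ℝ,
    IsFlMul flh Q.transpose A P ∧ IsFlMul flh P Q Ah ∧
      (((Ah.map fl).IsSymm ∧ Acomp = Ah.map fl) ∨ Acomp = flSymPart fl (Ah.map fl))

/-! ### The Jacobi algorithm in floating-point arithmetic -/

/-- The computed tangent `t = sign ζ / (|ζ| + √(1 + ζ²))`, `ζ = (b - a) / (2 c)`, of the angle of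
the rotation that diagonalizes `[a c; c b]` (`c ≠ 0`). -/
def flTan (fl : ℝ → ℝ) (a b c : ℝ) : ℝ :=
  let ζ := fl (fl (b - a) / fl (2 * c))
  fl ((if 0 ≤ ζ then 1 else -1) / fl (|ζ| + fl (Real.sqrt (fl (1 + fl (ζ * ζ))))))

/-- The computed cosine `1 / √(1 + t²)`. -/
def flCos (fl : ℝ → ℝ) (t : ℝ) : ℝ :=
  fl (1 / fl (Real.sqrt (fl (1 + fl (t * t)))))

/-- The computed sine `t cos`. -/
def flSin (fl : ℝ → ℝ) (t : ℝ) : ℝ := fl (flCos fl t * t)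

/-- One Jacobi rotation in floating point, with pivot `(i, j)`, applied to a symmetric matrix `H`.
With `t, cs, sn` the computed tangent, cosine and sine, the new pivot block is
`diag (hᵢᵢ - hᵢⱼ t, hⱼⱼ + hᵢⱼ t)`, and for `k ≠ i, j` the entries become
`hᵢₖ ← cs hᵢₖ - sn hⱼₖ`, `hⱼₖ ← sn hᵢₖ + cs hⱼₖ` (and symmetrically).
Nothing is done if `hᵢⱼ = 0`. -/
def jacobiStep {n : ℕ} (fl : ℝ → ℝ) (i j : Fin n) (H : Matrix (Fin n) (Fin n) ℝ) :
    Matrix (Fin n) (Fin n) ℝ :=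
  open Classical in
  if H i j = 0 then H
  else
    let t := flTan fl (H i i) (H j j) (H i j)
    let cs := flCos fl t
    let sn := flSin fl t
    let rowI : Fin n → ℝ := fun k => fl (fl (cs * H i k) - fl (sn * H j k))
    let rowJ : Fin n → ℝ := fun k => fl (fl (sn * H i k) + fl (cs * H j k))
    Matrix.of fun k l =>
      if k = i then
        if l = i then fl (H i i - fl (H i j * t))
        else if l = j then 0
        else rowI l
      else if k = j then
        if l = i then 0
        else if l = j then fl (H j j + fl (H i j * t))
        else rowJ l
      else
        if l = i then rowI k
        else if l = j then rowJ k
        else H k l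

/-- The matrix obtained from `H` by the successive rotations with the given pivots. -/
def jacobiIter {n : ℕ} (fl : ℝ → ℝ) (H : Matrix (Fin n) (Fin n) ℝ)
    (pivots : List (Fin n × Fin n)) : Matrix (Fin n) (Fin n) ℝ :=
  pivots.foldl (fun M p => jacobiStep fl p.1 p.2 M) H

/-- The stopping criterion `|hᵢⱼ| ≤ tol √(hᵢᵢ hⱼⱼ)` for all off-diagonal positions. -/
def StopCriterion {n : ℕ} (tol : ℝ) (H : Matrix (Fin n) (Fin n) ℝ) : Prop :=
  ∀ i j, i ≠ j → |H i j| ≤ tol * Real.sqrt (H i i * H j j)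

/-- A terminated run of the Jacobi algorithm on `H`, given by its list of pivots (in any order):
the final matrix satisfies the stopping criterion. -/
def IsJacobiRun {n : ℕ} (fl : ℝ → ℝ) (tol : ℝ) (H : Matrix (Fin n) (Fin n) ℝ)
    (pivots : List (Fin n × Fin n)) : Prop :=
  (∀ p ∈ pivots, p.1 ≠ p.2) ∧ StopCriterion tol (jacobiIter fl H pivots)

/-- The run consists of at most `S` sweeps, a sweep being `n (n - 1) / 2` rotations. -/
def AtMostSweeps {n : ℕ} (S : ℕ) (pivots : List (Fin n × Fin n)) : Prop :=
  pivots.length ≤ S * n.choose 2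

/-- The scaled condition number of every matrix to which a rotation of the run is applied is at
most `g` times that of the initial matrix. -/
def GrowthAtMost {n : ℕ} (fl : ℝ → ℝ) (H : Matrix (Fin n) (Fin n) ℝ)
    (pivots : List (Fin n × Fin n)) (g : ℝ) : Prop :=
  ∀ m < pivots.length, scaledCond (jacobiIter fl H (pivots.take m)) ≤ g * scaledCond H

/-- The `k`-th largest computed eigenvalue: the `k`-th largest diagonal entry of the final
matrix of the run. -/
def computedEig {n : ℕ} (fl : ℝ → ℝ) (H : Matrix (Fin n) (Fin n) ℝ)
    (pivots : List (Fin n × Fin n)) (k : Fin n) : ℝ :=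
  kthLargest (fun i => jacobiIter fl H pivots i i) k

end MixedJacobi

end

/-!
Eigenvalues of symmetric positive definite matrices are stable under perturbations that are small
relative to the quadratic form: if `|xᵀ B x - xᵀ A x| ≤ η xᵀ A x` for all `x`, then every ordered
eigenvalue of `B` agrees with that of `A` up to a factor `1 - η`. The same holds when the form of
`A` is first transformed by an orthogonal map (`factorClose_of_quadForm`), and Ostrowski's bound for
the nearly orthogonal congruence `Qᵀ A Q` (`lam_congruence_bounds`) comes from the same comparison
principle, `IsOrderedSpectrum.le_mul`. The algorithm is a chain of such perturbations.

* The computed preconditioned matrix differs from `Qᵀ A Q` by `O(n² κ u)` relative to the form,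
  where `κ` is the scaled condition number of `Qᵀ A Q` (`abs_quadForm_precond_sub_le`). The
  high-precision product has an error proportional to the norm of `A`, and the condition on the
  high precision absorbs the condition number of `A`; the demotion is an entrywise error, which only
  costs the scaled condition number.
* A rotation in floating point is an exact rotation of a matrix whose form differs by `O(u κ(H))`
  relative to that of `H` (`jacobiStep_factorClose`). There is no dimensional factor, because a row
  of the scaled matrix is bounded by the norm of that matrix (`sum_abs_row_le`), and no loss for
  graded matrices, because the tangent is at most twice the ratio of the smaller to the larger
  of the two diagonal scales (`rotTan_sq_mul_le`). There are at most `S n²` rotations, which gives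
  the term `S g`.
* A matrix that satisfies the stopping criterion differs from its diagonal by `n tol` relative to
  the form of the diagonal (`stopCriterion_factorClose`), which gives the term `c`.

Relative errors of the rotation coefficients are counted as powers of `1 - u` (`RelClose`): this
two-sided relation is stable under products, quotients, square roots and sums of nonnegative terms.
The congruence error is kept apart until the end, so that `p₁ u` enters the bound with coefficient
one (`relative_error_le`).
-/

namespace MixedJacobi

open Matrix

variable {n : ℕ}

/-! ### Quadratic forms and ordered spectra -/

/-- The quadratic form `xᵀ A x`. -/
def quadForm (A : Matrix (Fin n) (Fin n) ℝ) (x : Fin n → ℝ) : ℝ := x ⬝ᵥ A *ᵥ x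

lemma quadForm_eq_sum (A : Matrix (Fin n) (Fin n) ℝ) (x : Fin n → ℝ) :
    quadForm A x = ∑ i, ∑ j, A i j * x i * x j := by
  simp only [quadForm, dotProduct, mulVec, Finset.mul_sum]
  exact Finset.sum_congr rfl fun i _ => Finset.sum_congr rfl fun j _ => by ring

lemma quadForm_transpose_mul_mul (A Q : Matrix (Fin n) (Fin n) ℝ) (x : Fin n → ℝ) :
    quadForm (Qᵀ * A * Q) x = quadForm A (Q *ᵥ x) := by
  simp only [quadForm, ← mulVec_mulVec, dotProduct_mulVec, vecMul_transpose]

lemma quadForm_diagonal (v x : Fin n → ℝ) : quadForm (diagonal v) x = ∑ i, v i * x i ^ 2 := by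
  simp only [quadForm, dotProduct, mulVec_diagonal]
  exact Finset.sum_congr rfl fun i _ => by ring

lemma quadForm_sub (A B : Matrix (Fin n) (Fin n) ℝ) (x : Fin n → ℝ) :
    quadForm (A - B) x = quadForm A x - quadForm B x := by
  simp [quadForm, sub_mulVec, dotProduct_sub]

lemma dotProduct_self_eq_sum (x : Fin n → ℝ) : x ⬝ᵥ x = ∑ i, x i ^ 2 :=
  Finset.sum_congr rfl fun i _ => by ring

lemma zero_le_dotProduct_self (x : Fin n → ℝ) : 0 ≤ x ⬝ᵥ x := by
  rw [dotProduct_self_eq_sum]; positivity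

lemma dotProduct_self_pos {x : Fin n → ℝ} (hx : x ≠ 0) : 0 < x ⬝ᵥ x :=
  (zero_le_dotProduct_self x).lt_of_ne' fun h => hx (dotProduct_self_eq_zero.1 h)

lemma posDef_iff_quadForm {A : Matrix (Fin n) (Fin n) ℝ} :
    A.PosDef ↔ A.IsSymm ∧ ∀ x, x ≠ 0 → 0 < quadForm A x := by
  rw [posDef_iff_dotProduct_mulVec]
  simp [IsHermitian, IsSymm, quadForm]

/-- `A = U diag(μ) Uᵀ` with `U` orthogonal and `μ` decreasing. -/
def IsOrderedSpectrum (A : Matrix (Fin n) (Fin n) ℝ) (μ : Fin n → ℝ) : Prop :=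
  Antitone μ ∧ ∃ U : Matrix (Fin n) (Fin n) ℝ, U * Uᵀ = 1 ∧ A = U * diagonal μ * Uᵀ

lemma mul_transpose_submatrix_eq_one {U : Matrix (Fin n) (Fin n) ℝ} (hU : U * Uᵀ = 1)
    (σ : Fin n ≃ Fin n) : U.submatrix id σ * (U.submatrix id σ)ᵀ = 1 := by
  rw [transpose_submatrix, submatrix_mul_equiv, hU]; simp

lemma submatrix_mul_diagonal_mul (U : Matrix (Fin n) (Fin n) ℝ) (v : Fin n → ℝ)
    (σ : Fin n ≃ Fin n) :
    U.submatrix id σ * diagonal (v ∘ σ) * (U.submatrix id σ)ᵀ = U * diagonal v * Uᵀ := by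
  rw [transpose_submatrix, ← submatrix_diagonal_equiv, submatrix_mul_equiv, submatrix_mul_equiv]
  simp

lemma isOrderedSpectrum_lam {A : Matrix (Fin n) (Fin n) ℝ} (hA : A.IsSymm) :
    IsOrderedSpectrum A (lam A) := by
  have hH : A.IsHermitian := by simpa [IsHermitian, IsSymm] using hA
  let σ : Fin n ≃ Fin n := (finCongr (Fintype.card_fin n).symm).trans
    (Fintype.equivOfCardEq (Fintype.card_fin _))
  have hlam : lam A = hH.eigenvalues ∘ σ := by
    funext k
    simp [lam, hA, IsHermitian.eigenvalues, σ]
  refine ⟨fun i j hij => ?_, (hH.eigenvectorUnitary : Matrix _ _ ℝ).submatrix id σ,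
    mul_transpose_submatrix_eq_one ?_ σ, ?_⟩
  · simp only [lam, hH, dif_pos]
    exact hH.eigenvalues₀_antitone (by simpa using hij)
  · have := Unitary.coe_mul_star_self hH.eigenvectorUnitary
    simpa [star_eq_conjTranspose] using this
  · rw [hlam, submatrix_mul_diagonal_mul]
    have := hH.spectral_theorem
    rw [Unitary.conjStarAlgAut_apply] at this
    simpa [star_eq_conjTranspose, Function.comp_def] using this

lemma isOrderedSpectrum_diagonal (v : Fin n → ℝ) :
    IsOrderedSpectrum (diagonal v) (kthLargest v) := by
  refine ⟨fun i j hij => ?_, (1 : Matrix (Fin n) (Fin n) ℝ).submatrix id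
    (Tuple.sort fun i => -v i), mul_transpose_submatrix_eq_one (by simp) _, ?_⟩
  · simpa [kthLargest] using Tuple.monotone_sort (fun i => -v i) hij
  · have := submatrix_mul_diagonal_mul 1 v (Tuple.sort fun i => -v i)
    rw [show kthLargest v = v ∘ (Tuple.sort fun i => -v i) from rfl, this]
    simp

lemma quadForm_conj_diagonal (U : Matrix (Fin n) (Fin n) ℝ) (μ x : Fin n → ℝ) :
    quadForm (U * diagonal μ * Uᵀ) x = ∑ i, μ i * (Uᵀ *ᵥ x) i ^ 2 := by
  rw [← quadForm_diagonal, ← quadForm_transpose_mul_mul, transpose_transpose]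

lemma sum_sq_transpose_mulVec {U : Matrix (Fin n) (Fin n) ℝ} (hU : U * Uᵀ = 1)
    (x : Fin n → ℝ) : ∑ i, (Uᵀ *ᵥ x) i ^ 2 = x ⬝ᵥ x := by
  have := quadForm_conj_diagonal U 1 x
  simp only [diagonal_one', mul_one, hU, quadForm, one_mulVec, Pi.one_apply, one_mul] at this
  exact this.symm

/-- Comparison of ordered eigenvalues across a linear substitution `φ`, a one-sided form of the
Courant-Fischer principle. Some nonzero `x` lies in the span of the `k + 1` leading eigenvectors
of `B` while `φ x` lies in the span of the `n - k` trailing eigenvectors of `A`. -/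
theorem IsOrderedSpectrum.le_mul {A B : Matrix (Fin n) (Fin n) ℝ} {α β : Fin n → ℝ}
    (hA : IsOrderedSpectrum A α) (hB : IsOrderedSpectrum B β)
    (φ : (Fin n → ℝ) →ₗ[ℝ] (Fin n → ℝ)) {μ s : ℝ} (hμ : 0 ≤ μ)
    (hform : ∀ x, quadForm B x ≤ μ * quadForm A (φ x))
    (hnorm : ∀ x, φ x ⬝ᵥ φ x ≤ s * (x ⬝ᵥ x)) (k : Fin n) (hk : 0 ≤ α k) :
    β k ≤ μ * s * α k := by
  obtain ⟨hα, U, hU, rfl⟩ := hA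
  obtain ⟨hβ, V, hV, rfl⟩ := hB
  -- the conditions that `φ x` has no leading and `x` no trailing components
  let L : (Fin n → ℝ) →ₗ[ℝ] (Fin n → ℝ) := LinearMap.pi fun l =>
    if l < k then LinearMap.proj l ∘ₗ Uᵀ.mulVecLin ∘ₗ φ
    else if l = k then 0 else LinearMap.proj l ∘ₗ Vᵀ.mulVecLin
  -- the component `k` of `L` vanishes, so `L` is not surjective
  have hnot : ¬ Function.Injective L := by
    rw [LinearMap.injective_iff_surjective]
    intro hs
    obtain ⟨x, hx⟩ := hs (Pi.single k 1)
    have := congrFun hx k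
    simp [L] at this
  obtain ⟨x, hLx, hx⟩ : ∃ x, L x = 0 ∧ x ≠ 0 := by
    by_contra! h
    exact hnot ((injective_iff_map_eq_zero L).2 h)
  have hlow : ∀ l, l < k → (Uᵀ *ᵥ φ x) l = 0 := fun l hl => by
    have := congrFun hLx l
    simpa [L, hl, mulVec_transpose] using this
  have hhigh : ∀ l, k < l → (Vᵀ *ᵥ x) l = 0 := fun l hl => by
    have := congrFun hLx l
    simpa [L, hl.not_gt, hl.ne', mulVec_transpose] using this
  have h1 : β k * (x ⬝ᵥ x) ≤ quadForm (V * diagonal β * Vᵀ) x := by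
    rw [quadForm_conj_diagonal, ← sum_sq_transpose_mulVec hV, Finset.mul_sum]
    refine Finset.sum_le_sum fun l _ => ?_
    rcases lt_or_ge k l with hl | hl
    · simp [hhigh l hl]
    · exact mul_le_mul_of_nonneg_right (hβ hl) (sq_nonneg _)
  have h2 : quadForm (U * diagonal α * Uᵀ) (φ x) ≤ α k * (φ x ⬝ᵥ φ x) := by
    rw [quadForm_conj_diagonal, ← sum_sq_transpose_mulVec hU, Finset.mul_sum]
    refine Finset.sum_le_sum fun l _ => ?_
    rcases lt_or_ge l k with hl | hl
    · simp [hlow l hl]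
    · exact mul_le_mul_of_nonneg_right (hα hl) (sq_nonneg _)
  have hpos := dotProduct_self_pos hx
  refine le_of_mul_le_mul_right ?_ hpos
  calc β k * (x ⬝ᵥ x) ≤ μ * quadForm (U * diagonal α * Uᵀ) (φ x) := h1.trans (hform x)
    _ ≤ μ * (α k * (s * (x ⬝ᵥ x))) := by
        refine mul_le_mul_of_nonneg_left (h2.trans ?_) hμ
        exact mul_le_mul_of_nonneg_left (hnorm x) hk
    _ = μ * s * α k * (x ⬝ᵥ x) := by ring

lemma exists_quadForm_eq_of_isOrderedSpectrum {A : Matrix (Fin n) (Fin n) ℝ} {α : Fin n → ℝ}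
    (hA : IsOrderedSpectrum A α) (k : Fin n) :
    ∃ x : Fin n → ℝ, x ⬝ᵥ x = 1 ∧ quadForm A x = α k := by
  obtain ⟨-, U, hU, rfl⟩ := hA
  have hU' : Uᵀ * U = 1 := mul_eq_one_comm.1 hU
  have h : Uᵀ *ᵥ (U *ᵥ Pi.single k 1) = Pi.single k 1 := by
    rw [mulVec_mulVec, hU', one_mulVec]
  refine ⟨U *ᵥ Pi.single k 1, ?_, ?_⟩
  · rw [← sum_sq_transpose_mulVec hU, h]
    simp [Pi.single_apply]
  · rw [quadForm_conj_diagonal, h]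
    simp [Pi.single_apply]

lemma IsOrderedSpectrum.pos {A : Matrix (Fin n) (Fin n) ℝ} {α : Fin n → ℝ}
    (h : IsOrderedSpectrum A α) (hA : A.PosDef) (k : Fin n) : 0 < α k := by
  obtain ⟨x, hx, hq⟩ := exists_quadForm_eq_of_isOrderedSpectrum h k
  rw [← hq]
  refine (posDef_iff_quadForm.1 hA).2 x ?_
  rintro rfl
  simp at hx

lemma lam_pos {A : Matrix (Fin n) (Fin n) ℝ} (hA : A.PosDef) (k : Fin n) : 0 < lam A k :=
  (isOrderedSpectrum_lam (posDef_iff_quadForm.1 hA).1).pos hA k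

/-- Rayleigh bounds: `cond2 A` is a quotient `L / l` of an upper and a lower bound of the form. -/
lemma exists_cond2_eq (hn : 0 < n) {A : Matrix (Fin n) (Fin n) ℝ} (hA : A.PosDef) :
    ∃ l L : ℝ, 0 < l ∧ cond2 A = L / l ∧
      ∀ x, l * (x ⬝ᵥ x) ≤ quadForm A x ∧ quadForm A x ≤ L * (x ⬝ᵥ x) := by
  obtain ⟨hα, U, hU, hAU⟩ := isOrderedSpectrum_lam (posDef_iff_quadForm.1 hA).1
  refine ⟨lam A ⟨n - 1, Nat.sub_lt hn one_pos⟩, lam A ⟨0, hn⟩, lam_pos hA _, by simp [cond2, hn],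
    fun x => ?_⟩
  have hq : quadForm A x = ∑ i, lam A i * (Uᵀ *ᵥ x) i ^ 2 := by
    conv_lhs => rw [hAU]
    exact quadForm_conj_diagonal U _ x
  rw [hq, ← sum_sq_transpose_mulVec hU, Finset.mul_sum, Finset.mul_sum]
  exact ⟨Finset.sum_le_sum fun i _ => mul_le_mul_of_nonneg_right
      (hα (Fin.mk_le_mk.2 (by have := i.2; omega))) (sq_nonneg _),
    Finset.sum_le_sum fun i _ => mul_le_mul_of_nonneg_right
      (hα (Fin.mk_le_mk.2 (Nat.zero_le _))) (sq_nonneg _)⟩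

lemma cond2_le (hn : 0 < n) {A : Matrix (Fin n) (Fin n) ℝ} (hA : A.IsSymm) {l L : ℝ} (hl : 0 < l)
    (h : ∀ x, l * (x ⬝ᵥ x) ≤ quadForm A x ∧ quadForm A x ≤ L * (x ⬝ᵥ x)) :
    cond2 A ≤ L / l := by
  have hs := isOrderedSpectrum_lam hA
  simp only [cond2, hn, dif_pos]
  obtain ⟨x, hx, hqx⟩ := exists_quadForm_eq_of_isOrderedSpectrum hs ⟨0, hn⟩
  obtain ⟨y, hy, hqy⟩ :=
    exists_quadForm_eq_of_isOrderedSpectrum hs ⟨n - 1, Nat.sub_lt hn one_pos⟩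
  have h1 := h x
  have h2 := (h y).1
  rw [hx, hqx, mul_one, mul_one] at h1
  rw [hy, hqy, mul_one] at h2
  exact div_le_div₀ (by linarith [h1.1]) h1.2 hl h2

/-! ### Condition numbers -/

/-- The squared norm `∑ hᵢᵢ xᵢ²` belonging to the scaling `D = diag (hᵢᵢ ^ (-1/2))`. -/
def diagForm (H : Matrix (Fin n) (Fin n) ℝ) (x : Fin n → ℝ) : ℝ := ∑ i, H i i * x i ^ 2

lemma quadForm_scaled (H : Matrix (Fin n) (Fin n) ℝ) (d x : Fin n → ℝ) :
    quadForm (diagonal d * H * diagonal d) x = quadForm H (fun i => d i * x i) := by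
  have := quadForm_transpose_mul_mul H (diagonal d) x
  rw [diagonal_transpose] at this
  rw [this]
  congr 1
  ext i
  simp [mulVec_diagonal]

lemma isSymm_scaled {H : Matrix (Fin n) (Fin n) ℝ} (hH : H.IsSymm) (d : Fin n → ℝ) :
    (diagonal d * H * diagonal d).IsSymm := by
  rw [IsSymm, transpose_mul, transpose_mul, diagonal_transpose, hH, mul_assoc]

/-- The scaled condition number measures the form of `H` against `diagForm H`. -/
lemma exists_scaledCond_eq (hn : 0 < n) {H : Matrix (Fin n) (Fin n) ℝ} (hH : H.PosDef) :
    ∃ l L : ℝ, 0 < l ∧ 1 ≤ L ∧ l ≤ 1 ∧ scaledCond H = L / l ∧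
      ∀ x, l * diagForm H x ≤ quadForm H x ∧ quadForm H x ≤ L * diagForm H x := by
  obtain ⟨hs, hp⟩ := posDef_iff_quadForm.1 hH
  set d : Fin n → ℝ := fun i => (Real.sqrt (H i i))⁻¹ with hd
  have hd0 : ∀ i, 0 < d i := fun i => inv_pos.2 (Real.sqrt_pos.2 (hH.diag_pos (i := i)))
  have hd2 : ∀ i, H i i * d i ^ 2 = 1 := fun i => by
    have := hH.diag_pos (i := i)
    simp only [hd, inv_pow, Real.sq_sqrt this.le]
    exact mul_inv_cancel₀ this.ne'
  have hpd : (diagonal d * H * diagonal d).PosDef := by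
    refine posDef_iff_quadForm.2 ⟨isSymm_scaled hs d, fun x hx => ?_⟩
    rw [quadForm_scaled]
    refine hp _ fun h => hx ?_
    ext i
    have := congrFun h i
    simpa [(hd0 i).ne'] using this
  obtain ⟨l, L, hl, hc, h⟩ := exists_cond2_eq hn hpd
  have key : ∀ x, l * diagForm H x ≤ quadForm H x ∧ quadForm H x ≤ L * diagForm H x := by
    intro x
    have h1 := h (fun i => (d i)⁻¹ * x i)
    have e1 : (fun i => d i * ((d i)⁻¹ * x i)) = x := by
      ext i; rw [← mul_assoc, mul_inv_cancel₀ (hd0 i).ne', one_mul]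
    have e2 : (fun i => (d i)⁻¹ * x i) ⬝ᵥ (fun i => (d i)⁻¹ * x i) = diagForm H x := by
      rw [dotProduct_self_eq_sum]
      refine Finset.sum_congr rfl fun i _ => ?_
      have := hd2 i
      have h0 := (hd0 i).ne'
      field_simp
      linear_combination (-(x i) ^ 2) * this
    rwa [quadForm_scaled, e1, e2] at h1
  have e : quadForm H (Pi.single ⟨0, hn⟩ 1) = H ⟨0, hn⟩ ⟨0, hn⟩ := by simp [quadForm]
  have e' : diagForm H (Pi.single ⟨0, hn⟩ 1) = H ⟨0, hn⟩ ⟨0, hn⟩ := by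
    simp [diagForm, Pi.single_apply]
  have hk := key (Pi.single ⟨0, hn⟩ 1)
  rw [e, e'] at hk
  have h0 := hH.diag_pos (i := ⟨0, hn⟩)
  exact ⟨l, L, hl, by nlinarith [hk.2], by nlinarith [hk.1], hc, key⟩

lemma scaledCond_le (hn : 0 < n) {H : Matrix (Fin n) (Fin n) ℝ} (hH : H.PosDef) {l L : ℝ}
    (hl : 0 < l)
    (h : ∀ x, l * diagForm H x ≤ quadForm H x ∧ quadForm H x ≤ L * diagForm H x) :
    scaledCond H ≤ L / l := by
  refine cond2_le hn (isSymm_scaled (posDef_iff_quadForm.1 hH).1 _) hl fun x => ?_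
  have := h fun i => (Real.sqrt (H i i))⁻¹ * x i
  have e : diagForm H (fun i => (Real.sqrt (H i i))⁻¹ * x i) = x ⬝ᵥ x := by
    rw [dotProduct_self_eq_sum]
    refine Finset.sum_congr rfl fun i _ => ?_
    have := hH.diag_pos (i := i)
    rw [mul_pow, inv_pow, Real.sq_sqrt this.le, ← mul_assoc, mul_inv_cancel₀ this.ne', one_mul]
  rwa [quadForm_scaled, ← e]

/-! ### Relative errors of floating-point expressions -/

/-- `x = r y` with `(1 - u) ^ k ≤ r ≤ (1 - u) ^ (-k)`: the number `x` carries at most `k` rounding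
errors relative to `y`. -/
def RelClose (u : ℝ) (k : ℕ) (x y : ℝ) : Prop :=
  ∃ r : ℝ, (1 - u) ^ k ≤ r ∧ r * (1 - u) ^ k ≤ 1 ∧ x = r * y

namespace RelClose

variable {u x x' y y' : ℝ} {k k' : ℕ}

lemma refl (x : ℝ) : RelClose u 0 x x := ⟨1, by simp, by simp, by simp⟩

lemma neg (h : RelClose u k x y) : RelClose u k (-x) (-y) := by
  obtain ⟨r, h1, h2, rfl⟩ := h
  exact ⟨r, h1, h2, by ring⟩

lemma pow_pos_aux (h1 : u < 1) (k : ℕ) : 0 < (1 - u) ^ k := pow_pos (by linarith) k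

variable (h0 : 0 ≤ u) (h1 : u < 1)
include h1

lemma mul (h : RelClose u k x y) (h' : RelClose u k' x' y') :
    RelClose u (k + k') (x * x') (y * y') := by
  obtain ⟨r, h2, h3, rfl⟩ := h
  obtain ⟨r', h2', h3', rfl⟩ := h'
  have p := pow_pos_aux h1 k
  have p' := pow_pos_aux h1 k'
  refine ⟨r * r', ?_, ?_, by ring⟩
  · rw [pow_add]; exact mul_le_mul h2 h2' p'.le (p.le.trans h2)
  · calc r * r' * (1 - u) ^ (k + k') = (r * (1 - u) ^ k) * (r' * (1 - u) ^ k') := by ring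
      _ ≤ 1 := mul_le_one₀ h3 (mul_nonneg (p'.le.trans h2') p'.le) h3'

lemma div (h : RelClose u k x y) (h' : RelClose u k' x' y') :
    RelClose u (k + k') (x / x') (y / y') := by
  obtain ⟨r', h2', h3', rfl⟩ := h'
  have p' := pow_pos_aux h1 k'
  have hr' : 0 < r' := p'.trans_le h2'
  have hinv : RelClose u k' (r' * y')⁻¹ y'⁻¹ := by
    refine ⟨r'⁻¹, ?_, ?_, by rw [mul_inv]⟩
    · rw [le_inv_comm₀ p' hr', ← one_div, le_div_iff₀ p']; exact h3'
    · rw [inv_mul_le_one₀ hr']; exact h2'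
  simpa [div_eq_mul_inv] using h.mul h1 hinv

lemma abs (h : RelClose u k x y) : RelClose u k |x| |y| := by
  obtain ⟨r, h2, h3, rfl⟩ := h
  have p := pow_pos_aux h1 k
  exact ⟨r, h2, h3, by rw [abs_mul, abs_of_nonneg (p.le.trans h2)]⟩

lemma add_of_nonneg (h : RelClose u k x y) (h' : RelClose u k x' y') (hy : 0 ≤ y) (hy' : 0 ≤ y') :
    RelClose u k (x + x') (y + y') := by
  obtain ⟨r, h2, h3, rfl⟩ := h
  obtain ⟨r', h2', h3', rfl⟩ := h'
  have p := pow_pos_aux h1 k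
  rcases (add_nonneg hy hy').eq_or_lt' with hs | hs
  · obtain rfl : y = 0 := by linarith
    obtain rfl : y' = 0 := by linarith
    exact ⟨r, h2, h3, by simp⟩
  · refine ⟨(r * y + r' * y') / (y + y'), ?_, ?_, (div_mul_cancel₀ _ hs.ne').symm⟩
    · rw [le_div_iff₀ hs]; nlinarith
    · rw [div_mul_eq_mul_div, div_le_one hs]; nlinarith

lemma nonneg_iff (h : RelClose u k x y) : 0 ≤ x ↔ 0 ≤ y := by
  obtain ⟨r, h2, h3, rfl⟩ := h
  exact mul_nonneg_iff_of_pos_left ((pow_pos_aux h1 k).trans_le h2)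

include h0

lemma mono (h : RelClose u k x y) (hk : k ≤ k') : RelClose u k' x y := by
  obtain ⟨r, h2, h3, rfl⟩ := h
  have hle : (1 - u) ^ k' ≤ (1 - u) ^ k :=
    pow_le_pow_of_le_one (by linarith) (by linarith) hk
  have := pow_pos_aux h1 k
  exact ⟨r, hle.trans h2, (mul_le_mul_of_nonneg_left hle (this.le.trans h2)).trans h3, rfl⟩

lemma sqrt (h : RelClose u k x y) : RelClose u k (Real.sqrt x) (Real.sqrt y) := by
  obtain ⟨r, h2, h3, rfl⟩ := h
  have p := pow_pos_aux h1 k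
  have p1 : (1 - u) ^ k ≤ 1 := pow_le_one₀ (by linarith) (by linarith)
  have hr : 0 ≤ r := p.le.trans h2
  refine ⟨Real.sqrt r, ?_, ?_, Real.sqrt_mul hr y⟩
  · exact Real.le_sqrt_of_sq_le (by nlinarith)
  · rw [← le_div_iff₀ p, Real.sqrt_le_left (by positivity)]
    have : r ≤ 1 / (1 - u) ^ k := by rwa [le_div_iff₀ p]
    exact this.trans (le_self_pow₀ ((one_le_div p).2 p1) two_ne_zero)

lemma fl {fl : ℝ → ℝ} (hfl : IsRounding u fl) (h : RelClose u k x y) :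
    RelClose u (k + 1) (fl x) y := by
  have h' : RelClose u 1 (fl x) x := by
    rcases eq_or_ne x 0 with rfl | hx
    · have := hfl 0
      simp only [sub_zero, abs_zero, mul_zero, abs_nonpos_iff] at this
      rw [this]
      exact (refl 0).mono h0 h1 zero_le_one
    · refine ⟨fl x / x, ?_, ?_, (div_mul_cancel₀ _ hx).symm⟩ <;>
      · have h2 : |fl x / x - 1| ≤ u := by
          rw [div_sub_one hx, abs_div, div_le_iff₀ (abs_pos.2 hx)]; exact hfl x
        have := abs_le.1 h2
        rw [pow_one]
        nlinarith
  obtain ⟨r, h2, h3, rfl⟩ := h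
  obtain ⟨r', h2', h3', he⟩ := h'
  have p := pow_pos_aux h1 k
  rw [pow_one] at h2' h3'
  refine ⟨r' * r, ?_, ?_, by rw [he]; ring⟩
  · rw [pow_succ']; exact mul_le_mul h2' h2 p.le (by linarith)
  · calc r' * r * (1 - u) ^ (k + 1) = (r' * (1 - u)) * (r * (1 - u) ^ k) := by ring
      _ ≤ 1 := mul_le_one₀ h3' (mul_nonneg (p.le.trans h2) p.le) h3

lemma abs_sub_le (h : RelClose u k x y) (hk : k * u ≤ 1 / 2) :
    |x - y| ≤ 2 * k * u * |y| := by
  obtain ⟨r, h2, h3, rfl⟩ := h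
  have hb : 1 - k * u ≤ (1 - u) ^ k := by
    have := one_add_mul_le_pow (a := -u) (by linarith) k
    simpa [sub_eq_add_neg] using this
  have p := pow_pos_aux h1 k
  have hr : 0 < r := p.trans_le h2
  rw [show r * y - y = (r - 1) * y by ring, abs_mul]
  refine mul_le_mul_of_nonneg_right (abs_le.2 ⟨?_, ?_⟩) (abs_nonneg y)
  · have : (0 : ℝ) ≤ k * u := by positivity
    linarith
  · have h5 : r * (1 - k * u) ≤ 1 := (mul_le_mul_of_nonneg_left hb hr.le).trans h3
    have : (0 : ℝ) ≤ k * u := by positivity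
    nlinarith

lemma abs_fl_add_sub_le {fl : ℝ → ℝ} (hfl : IsRounding u fl) (h : RelClose u k x y)
    (h' : RelClose u k x' y') (hk : (k + 1) * u ≤ 1 / 2) :
    |fl (x + x') - (y + y')| ≤ 2 * (k + 1) * u * (|y| + |y'|) := by
  obtain ⟨s, hs1, hs2, hs⟩ := (refl (u := u) (x + x')).fl h0 h1 hfl
  have hsc : ∀ a b, RelClose u k a b → RelClose u (k + 1) (s * a) b := fun a b hab => by
    have := RelClose.mul h1 (⟨s, hs1, hs2, by ring⟩ : RelClose u (0 + 1) s 1) hab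
    simpa [add_comm] using this
  have e1 := (hsc x y h).abs_sub_le h0 h1 (by push_cast; exact hk)
  have e2 := (hsc x' y' h').abs_sub_le h0 h1 (by push_cast; exact hk)
  push_cast at e1 e2
  rw [hs, show s * (x + x') - (y + y') = (s * x - y) + (s * x' - y') by ring, mul_add]
  exact (abs_add_le _ _).trans (add_le_add e1 e2)

lemma abs_fl_sub_sub_le {fl : ℝ → ℝ} (hfl : IsRounding u fl) (h : RelClose u k x y)
    (h' : RelClose u k x' y') (hk : (k + 1) * u ≤ 1 / 2) :
    |fl (x - x') - (y - y')| ≤ 2 * (k + 1) * u * (|y| + |y'|) := by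
  simpa [sub_eq_add_neg] using h.abs_fl_add_sub_le h0 h1 hfl h'.neg hk

end RelClose

/-! ### The exact and the computed rotation -/

/-- The exact tangent of the angle of the rotation that diagonalizes `[a c; c b]`, the root
of smaller modulus of `t² + 2 ζ t = 1` with `ζ = (b - a) / (2 c)`, and `1` for `ζ = 0`. It is
meaningful for `c ≠ 0` only. -/
noncomputable def rotTan (a b c : ℝ) : ℝ :=
  (if 0 ≤ (b - a) / (2 * c) then 1 else -1) /
    (|(b - a) / (2 * c)| + Real.sqrt (1 + (b - a) / (2 * c) * ((b - a) / (2 * c))))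

/-- The cosine of the angle in `(-π / 2, π / 2)` with tangent `t`. -/
noncomputable def rotCos (t : ℝ) : ℝ := 1 / Real.sqrt (1 + t * t)

lemma rotCos_pos (t : ℝ) : 0 < rotCos t :=
  one_div_pos.2 (Real.sqrt_pos.2 (by nlinarith [mul_self_nonneg t]))

lemma rotCos_le_one (t : ℝ) : rotCos t ≤ 1 := by
  unfold rotCos
  rw [div_le_one (Real.sqrt_pos.2 (by nlinarith [mul_self_nonneg t]))]
  exact Real.one_le_sqrt.2 (by nlinarith)

lemma rotCos_sq (t : ℝ) : rotCos t ^ 2 * (1 + t ^ 2) = 1 := by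
  unfold rotCos
  rw [div_pow, Real.sq_sqrt (by nlinarith)]
  have : 1 + t * t ≠ 0 := by nlinarith
  field_simp

lemma rotTan_quadratic (a b : ℝ) {c : ℝ} (hc : c ≠ 0) :
    c * (1 - rotTan a b c ^ 2) = (b - a) * rotTan a b c := by
  have hz : b - a = 2 * c * ((b - a) / (2 * c)) := by field_simp
  unfold rotTan
  set z := (b - a) / (2 * c)
  rw [hz]
  have hw : Real.sqrt (1 + z * z) ^ 2 = 1 + z * z := Real.sq_sqrt (by nlinarith)
  have hwp : 0 < Real.sqrt (1 + z * z) := Real.sqrt_pos.2 (by nlinarith)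
  set w := Real.sqrt (1 + z * z)
  split_ifs with h
  · rw [abs_of_nonneg h]
    have : z + w ≠ 0 := by positivity
    field_simp
    linear_combination hw
  · push Not at h
    rw [abs_of_neg h]
    have : -z + w ≠ 0 := by linarith
    field_simp
    linear_combination hw

lemma abs_rotTan (a b c : ℝ) : |rotTan a b c| =
    1 / (|(b - a) / (2 * c)| + Real.sqrt (1 + (b - a) / (2 * c) * ((b - a) / (2 * c)))) := by
  unfold rotTan
  rw [abs_div, abs_of_nonneg (a := _ + Real.sqrt _) (by positivity)]
  congr 1
  split_ifs <;> simp

lemma abs_rotTan_le_one (a b c : ℝ) : |rotTan a b c| ≤ 1 := by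
  rw [abs_rotTan]
  set z := (b - a) / (2 * c)
  have : 1 ≤ Real.sqrt (1 + z * z) := Real.one_le_sqrt.2 (by nlinarith)
  have h0 := abs_nonneg z
  rw [div_le_one (by linarith)]
  linarith

lemma abs_rotTan_mul_le (a b : ℝ) {c : ℝ} (hc : c ≠ 0) : |rotTan a b c| * |b - a| ≤ |c| := by
  have hz : b - a = 2 * c * ((b - a) / (2 * c)) := by field_simp
  rw [abs_rotTan]
  set z := (b - a) / (2 * c)
  have h1 : |z| ≤ Real.sqrt (1 + z * z) := Real.abs_le_sqrt (by nlinarith)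
  have h2 : 0 < Real.sqrt (1 + z * z) := Real.sqrt_pos.2 (by nlinarith)
  have h0 := abs_nonneg z
  rw [hz, abs_mul, abs_mul, abs_two, one_div, inv_mul_le_iff₀ (by linarith)]
  nlinarith [abs_nonneg c]

/-- The tangent is small when the two diagonal entries differ much in size. Hence the rotation
does not mix a large diagonal scale into a small one. -/
lemma rotTan_sq_mul_le {a b c : ℝ} (ha : 0 < a) (hb : 0 < b) (hc : c ≠ 0) (hab : c ^ 2 ≤ a * b) :
    rotTan a b c ^ 2 * a ≤ 4 * b ∧ rotTan a b c ^ 2 * b ≤ 4 * a := by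
  have h1 : rotTan a b c ^ 2 ≤ 1 := by
    rw [← sq_abs]
    exact pow_le_one₀ (abs_nonneg _) (abs_rotTan_le_one a b c)
  have h2 : rotTan a b c ^ 2 * (b - a) ^ 2 ≤ a * b := by
    refine le_trans ?_ hab
    rw [← mul_pow, ← sq_abs, ← sq_abs c, abs_mul]
    exact pow_le_pow_left₀ (by positivity) (abs_rotTan_mul_le a b hc) 2
  set T := rotTan a b c ^ 2
  have hT : 0 ≤ T := sq_nonneg _
  have aux : ∀ p q : ℝ, 0 < p → 0 < q → T * (p - q) ^ 2 ≤ p * q → T * p ≤ 4 * q := by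
    intro p q hp hq h
    rcases le_or_gt p (4 * q) with hpq | hpq
    · nlinarith
    · have h3 : (p / 2) ^ 2 ≤ (p - q) ^ 2 := pow_le_pow_left₀ (by linarith) (by linarith) 2
      have h4 : T * (p / 2) ^ 2 ≤ p * q := (mul_le_mul_of_nonneg_left h3 hT).trans h
      refine le_of_mul_le_mul_left ?_ hp
      nlinarith
  exact ⟨aux a b ha hb (by rwa [← neg_sub b a, neg_sq]), aux b a hb ha (by linarith)⟩

section

variable {u : ℝ} {fl : ℝ → ℝ} (h0 : 0 ≤ u) (h1 : u < 1) (hfl : IsRounding u fl)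
include h0 h1 hfl

lemma relClose_flTan (a b c : ℝ) : RelClose u 11 (flTan fl a b c) (rotTan a b c) := by
  have hz : RelClose u 3 (fl (fl (b - a) / fl (2 * c))) ((b - a) / (2 * c)) :=
    (((RelClose.refl _).fl h0 h1 hfl).div h1 ((RelClose.refl _).fl h0 h1 hfl)).fl h0 h1 hfl
  simp only [flTan, rotTan, hz.nonneg_iff h1]
  have hzz := (hz.mul h1 hz).fl h0 h1 hfl
  have hs := ((((RelClose.refl 1).mono h0 h1 (Nat.zero_le 7)).add_of_nonneg h1 hzz
    zero_le_one (mul_self_nonneg _)).fl h0 h1 hfl).sqrt h0 h1 |>.fl h0 h1 hfl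
  have hd := ((((hz.abs h1).mono h0 h1 (by norm_num : 3 ≤ 9)).add_of_nonneg h1 hs
    (abs_nonneg _) (Real.sqrt_nonneg _)).fl h0 h1 hfl)
  exact (((RelClose.refl _).div h1 hd).fl h0 h1 hfl).mono h0 h1 (by norm_num)

lemma relClose_flCos {k : ℕ} {t s : ℝ} (ht : RelClose u k t s) :
    RelClose u (2 * k + 4) (flCos fl t) (rotCos s) := by
  have hzz := (ht.mul h1 ht).fl h0 h1 hfl
  have hs := ((((RelClose.refl 1).mono h0 h1 (Nat.zero_le _)).add_of_nonneg h1 hzz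
    zero_le_one (mul_self_nonneg _)).fl h0 h1 hfl).sqrt h0 h1 |>.fl h0 h1 hfl
  exact (((RelClose.refl 1).div h1 hs).fl h0 h1 hfl).mono h0 h1 (by omega)

lemma relClose_flSin {k : ℕ} {t s : ℝ} (ht : RelClose u k t s) :
    RelClose u (3 * k + 5) (flSin fl t) (rotCos s * s) :=
  (((relClose_flCos h0 h1 hfl ht).mul h1 ht).fl h0 h1 hfl).mono h0 h1 (by omega)

end

/-! ### Cauchy-Schwarz inequalities for positive definite forms -/

lemma dotProduct_mulVec_comm {H : Matrix (Fin n) (Fin n) ℝ} (hs : H.IsSymm) (x y : Fin n → ℝ) :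
    x ⬝ᵥ H *ᵥ y = y ⬝ᵥ H *ᵥ x := by
  rw [dotProduct_mulVec, ← mulVec_transpose, hs, dotProduct_comm]

lemma quadForm_nonneg {H : Matrix (Fin n) (Fin n) ℝ} (hH : H.PosDef) (x : Fin n → ℝ) :
    0 ≤ quadForm H x := by
  rcases eq_or_ne x 0 with rfl | hx
  · simp [quadForm]
  · exact ((posDef_iff_quadForm.1 hH).2 x hx).le

lemma dotProduct_mulVec_sq_le {H : Matrix (Fin n) (Fin n) ℝ} (hH : H.PosDef)
    (x y : Fin n → ℝ) : (x ⬝ᵥ H *ᵥ y) ^ 2 ≤ quadForm H x * quadForm H y := by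
  have hs := (posDef_iff_quadForm.1 hH).1
  have h : ∀ t : ℝ, 0 ≤ quadForm H y * (t * t) + 2 * (x ⬝ᵥ H *ᵥ y) * t + quadForm H x := by
    intro t
    have := quadForm_nonneg hH (x + t • y)
    simp only [quadForm, mulVec_add, mulVec_smul, add_dotProduct, dotProduct_add, smul_dotProduct,
      dotProduct_smul, smul_eq_mul, dotProduct_mulVec_comm hs y x] at this
    simp only [quadForm]
    linarith
  have := discrim_le_zero h
  rw [discrim] at this
  nlinarith

lemma quadForm_single (H : Matrix (Fin n) (Fin n) ℝ) (i : Fin n) :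
    quadForm H (Pi.single i 1) = H i i := by
  simp [quadForm]

lemma entry_sq_le {H : Matrix (Fin n) (Fin n) ℝ} (hH : H.PosDef) (i j : Fin n) :
    H i j ^ 2 ≤ H i i * H j j := by
  have := dotProduct_mulVec_sq_le hH (Pi.single i 1) (Pi.single j 1)
  simpa [quadForm_single] using this

lemma diagForm_nonneg {H : Matrix (Fin n) (Fin n) ℝ} (hH : H.PosDef) (x : Fin n → ℝ) :
    0 ≤ diagForm H x :=
  Finset.sum_nonneg fun i _ => mul_nonneg (hH.diag_pos (i := i)).le (sq_nonneg _)

/-- A row of `H` is bounded by the upper bound `L` of the scaled form, with no dimensional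
factor. -/
lemma sum_abs_row_le {H : Matrix (Fin n) (Fin n) ℝ} (hH : H.PosDef) {L : ℝ} (hL : 0 ≤ L)
    (hup : ∀ x, quadForm H x ≤ L * diagForm H x) (i : Fin n) (y : Fin n → ℝ) :
    ∑ k, |H i k| * |y k| ≤ Real.sqrt (H i i) * Real.sqrt (L * diagForm H y) := by
  -- signs chosen to turn the row sum into a value of the bilinear form
  let w : Fin n → ℝ := fun k => SignType.sign (H i k) * |y k|
  have e : Pi.single i 1 ⬝ᵥ H *ᵥ w = ∑ k, |H i k| * |y k| := by
    rw [single_one_dotProduct, mulVec, dotProduct]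
    refine Finset.sum_congr rfl fun k _ => ?_
    rw [← mul_assoc, self_mul_sign]
  have hw : diagForm H w ≤ diagForm H y := by
    refine Finset.sum_le_sum fun k _ =>
      mul_le_mul_of_nonneg_left ?_ (hH.diag_pos (i := k)).le
    have hs : |((SignType.sign (H i k) : SignType) : ℝ)| ≤ 1 := by
      rcases lt_trichotomy (H i k) 0 with h | h | h <;> simp [h]
    simp only [w, mul_pow, sq_abs]
    have := (sq_le_one_iff_abs_le_one _).2 hs
    nlinarith [sq_nonneg (y k)]
  have h := dotProduct_mulVec_sq_le hH (Pi.single i 1) w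
  rw [quadForm_single, e] at h
  rw [← Real.sqrt_mul (hH.diag_pos (i := i)).le]
  refine Real.le_sqrt_of_sq_le (h.trans ?_)
  exact mul_le_mul_of_nonneg_left ((hup w).trans (mul_le_mul_of_nonneg_left hw hL))
    (hH.diag_pos (i := i)).le

/-! ### Eigenvalues of nearby forms -/

/-- The vectors `α` and `β` agree up to the factor `ρ ≤ 1`, componentwise. -/
def FactorClose (ρ : ℝ) (α β : Fin n → ℝ) : Prop :=
  ∀ k, ρ * α k ≤ β k ∧ ρ * β k ≤ α k

lemma FactorClose.symm {ρ : ℝ} {α β : Fin n → ℝ} (h : FactorClose ρ α β) : FactorClose ρ β α :=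
  fun k => ⟨(h k).2, (h k).1⟩

lemma FactorClose.trans {ρ σ : ℝ} (hρ : 0 ≤ ρ) (hσ : 0 ≤ σ) {α β γ : Fin n → ℝ}
    (h : FactorClose ρ α β) (h' : FactorClose σ β γ) : FactorClose (ρ * σ) α γ := fun k =>
  ⟨by nlinarith [mul_le_mul_of_nonneg_left (h k).1 hσ, (h' k).1],
    by nlinarith [mul_le_mul_of_nonneg_left (h' k).2 hρ, (h k).2]⟩

lemma FactorClose.mono {ρ σ : ℝ} (hρσ : ρ ≤ σ) {α β : Fin n → ℝ} (hα : ∀ k, 0 ≤ α k)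
    (hβ : ∀ k, 0 ≤ β k) (h : FactorClose σ α β) : FactorClose ρ α β := fun k =>
  ⟨(mul_le_mul_of_nonneg_right hρσ (hα k)).trans (h k).1,
    (mul_le_mul_of_nonneg_right hρσ (hβ k)).trans (h k).2⟩

/-- Relative perturbation of eigenvalues: a form that differs from an orthogonal transform of `A`
by a small multiple of that transform. -/
theorem factorClose_of_quadForm {A B : Matrix (Fin n) (Fin n) ℝ} (hA : A.PosDef) (hB : B.IsSymm)
    {α β : Fin n → ℝ} (hα : IsOrderedSpectrum A α) (hβ : IsOrderedSpectrum B β)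
    (φ ψ : (Fin n → ℝ) →ₗ[ℝ] (Fin n → ℝ)) (hφ : ∀ x, φ x ⬝ᵥ φ x = x ⬝ᵥ x)
    (hφψ : ∀ x, φ (ψ x) = x) {η : ℝ} (hη : η < 1)
    (h : ∀ x, |quadForm B x - quadForm A (φ x)| ≤ η * quadForm A (φ x)) :
    B.PosDef ∧ FactorClose (1 - η) α β := by
  have hBpos : B.PosDef := by
    refine posDef_iff_quadForm.2 ⟨hB, fun x hx => ?_⟩
    have hφx : φ x ≠ 0 := fun h0 => by
      have := hφ x
      rw [h0, dotProduct_zero] at this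
      exact (dotProduct_self_pos hx).ne this
    have h1 := (abs_le.1 (h x)).1
    have h2 := (posDef_iff_quadForm.1 hA).2 _ hφx
    nlinarith
  refine ⟨hBpos, fun k => ?_⟩
  have hαk := hα.pos hA k
  have hβk := hβ.pos hBpos k
  have hη0 : 0 ≤ η := by
    obtain ⟨x, hx, -⟩ := exists_quadForm_eq_of_isOrderedSpectrum hα k
    have hx0 : x ≠ 0 := by rintro rfl; simp at hx
    have hp := (posDef_iff_quadForm.1 hA).2 x hx0
    have := (abs_nonneg _).trans (h (ψ x))
    rw [hφψ] at this
    exact nonneg_of_mul_nonneg_left this hp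
  constructor
  · have := hβ.le_mul hα ψ (μ := (1 - η)⁻¹) (s := 1) (inv_nonneg.2 (by linarith))
      (fun x => ?_) (fun x => ?_) k hβk.le
    · rw [mul_one, inv_mul_eq_div, le_div_iff₀ (by linarith)] at this
      linarith
    · have h1 := (abs_le.1 (h (ψ x))).1
      rw [hφψ] at h1
      rw [inv_mul_eq_div, le_div_iff₀ (by linarith)]
      linarith
    · rw [one_mul, ← hφ (ψ x), hφψ]
  · have := hα.le_mul hβ φ (μ := 1 + η) (s := 1) (by linarith)
      (fun x => by linarith [(abs_le.1 (h x)).2]) (fun x => by rw [one_mul, hφ]) k hαk.le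
    nlinarith [mul_nonneg (sq_nonneg η) hαk.le]

/-! ### One rotation -/

/-- The plane rotation `x ↦ (cs xᵢ + sn xⱼ, -sn xᵢ + cs xⱼ)` in the coordinates `i` and `j`. -/
def planeRot (i j : Fin n) (cs sn : ℝ) : (Fin n → ℝ) →ₗ[ℝ] (Fin n → ℝ) where
  toFun x k := if k = i then cs * x i + sn * x j else if k = j then -sn * x i + cs * x j else x k
  map_add' x y := by
    ext k
    simp only [Pi.add_apply]
    split_ifs <;> ring
  map_smul' a x := by
    ext k
    simp only [Pi.smul_apply, smul_eq_mul, RingHom.id_apply]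
    split_ifs <;> ring

section
variable {i j : Fin n} (hij : i ≠ j) (cs sn : ℝ) (x : Fin n → ℝ)

lemma planeRot_left : planeRot i j cs sn x i = cs * x i + sn * x j := by simp [planeRot]

include hij in
lemma planeRot_right : planeRot i j cs sn x j = -sn * x i + cs * x j := by
  simp [planeRot, hij.symm]

lemma planeRot_of_ne {k : Fin n} (hki : k ≠ i) (hkj : k ≠ j) : planeRot i j cs sn x k = x k := by
  simp [planeRot, hki, hkj]

include hij

lemma sum_eq_pair_add (f : Fin n → ℝ) :
    ∑ k, f k = f i + f j + ∑ k ∈ (Finset.univ.erase i).erase j, f k := by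
  rw [← Finset.add_sum_erase _ f (Finset.mem_univ i), ← Finset.add_sum_erase (Finset.univ.erase i) f
    (Finset.mem_erase.2 ⟨hij.symm, Finset.mem_univ j⟩), add_assoc]

lemma planeRot_dotProduct_self (h : cs ^ 2 + sn ^ 2 = 1) :
    planeRot i j cs sn x ⬝ᵥ planeRot i j cs sn x = x ⬝ᵥ x := by
  rw [dotProduct_self_eq_sum, dotProduct_self_eq_sum, sum_eq_pair_add hij, sum_eq_pair_add hij,
    planeRot_left, planeRot_right hij]
  congr 1
  · linear_combination (x i ^ 2 + x j ^ 2) * h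
  · refine Finset.sum_congr rfl fun k hk => ?_
    simp only [Finset.mem_erase] at hk
    rw [planeRot_of_ne _ _ _ hk.2.1 hk.1]

lemma planeRot_planeRot_neg (h : cs ^ 2 + sn ^ 2 = 1) :
    planeRot i j cs sn (planeRot i j cs (-sn) x) = x := by
  ext k
  by_cases hki : k = i
  · subst hki
    rw [planeRot_left, planeRot_left, planeRot_right hij]
    linear_combination x k * h
  by_cases hkj : k = j
  · subst hkj
    rw [planeRot_right hij, planeRot_left, planeRot_right hij]
    linear_combination x k * h
  rw [planeRot_of_ne _ _ _ hki hkj, planeRot_of_ne _ _ _ hki hkj]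

lemma quadForm_eq_pair_add {H : Matrix (Fin n) (Fin n) ℝ} (hs : H.IsSymm) :
    quadForm H x = H i i * x i ^ 2 + H j j * x j ^ 2 + 2 * H i j * x i * x j +
      2 * ∑ k ∈ (Finset.univ.erase i).erase j, (H i k * x i + H j k * x j) * x k +
      ∑ k ∈ (Finset.univ.erase i).erase j, ∑ l ∈ (Finset.univ.erase i).erase j,
        H k l * x k * x l := by
  rw [quadForm_eq_sum, sum_eq_pair_add hij]
  simp only [sum_eq_pair_add hij (fun l => H _ l * x _ * x l)]
  rw [Finset.sum_add_distrib, Finset.mul_sum]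
  have e : ∑ k ∈ (Finset.univ.erase i).erase j, 2 * ((H i k * x i + H j k * x j) * x k) =
      ∑ k ∈ (Finset.univ.erase i).erase j, H i k * x i * x k +
      ∑ k ∈ (Finset.univ.erase i).erase j, H j k * x j * x k +
      ∑ k ∈ (Finset.univ.erase i).erase j, (H k i * x k * x i + H k j * x k * x j) := by
    rw [← Finset.sum_add_distrib, ← Finset.sum_add_distrib]
    refine Finset.sum_congr rfl fun k _ => ?_
    rw [hs.apply i k, hs.apply j k]
    ring
  rw [e, hs.apply i j]
  ring

end

/-- The entries of the rotated matrix differ from those of the exactly rotated one only in the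
rows and columns of the pivots, each by at most `e` times the absolute values combined in it. The
exact rotation has the tangent `T` and annihilates the pivot. -/
structure IsPerturbedRotation (H H' : Matrix (Fin n) (Fin n) ℝ) (i j : Fin n) (T e : ℝ) : Prop where
  symm : H'.IsSymm
  pivot : H' i j = 0
  diag_left : |H' i i - (H i i - H i j * T)| ≤ e * (|H i i| + |H i j * T|)
  diag_right : |H' j j - (H j j + H i j * T)| ≤ e * (|H j j| + |H i j * T|)
  row_left : ∀ k, k ≠ i → k ≠ j →
    |H' i k - (rotCos T * H i k - rotCos T * T * H j k)| ≤ e * (|H i k| + |T| * |H j k|)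
  row_right : ∀ k, k ≠ i → k ≠ j →
    |H' j k - (rotCos T * T * H i k + rotCos T * H j k)| ≤ e * (|T| * |H i k| + |H j k|)
  rest : ∀ k l, k ≠ i → k ≠ j → l ≠ i → l ≠ j → H' k l = H k l

lemma isPerturbedRotation_jacobiStep {u : ℝ} {fl : ℝ → ℝ} (h0 : 0 ≤ u) (hu : 80 * u ≤ 1)
    (hfl : IsRounding u fl) {H : Matrix (Fin n) (Fin n) ℝ} (hs : H.IsSymm) {i j : Fin n}
    (hij : i ≠ j) (hc : H i j ≠ 0) :
    IsPerturbedRotation H (jacobiStep fl i j H) i j (rotTan (H i i) (H j j) (H i j))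
      (80 * u) := by
  have h1 : u < 1 := by linarith
  have hT := relClose_flTan h0 h1 hfl (H i i) (H j j) (H i j)
  set T := rotTan (H i i) (H j j) (H i j)
  have hcos := relClose_flCos h0 h1 hfl hT
  have hsin := relClose_flSin h0 h1 hfl hT
  -- every term carries at most 39 rounding errors before the last operation
  have hk : ((39 : ℕ) + 1) * u ≤ 1 / 2 := by push_cast; linarith
  have hce : 2 * (((39 : ℕ) : ℝ) + 1) * u = 80 * u := by push_cast; ring
  have hcm : ∀ y, RelClose u 39 (fl (flCos fl (flTan fl (H i i) (H j j) (H i j)) * y))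
      (rotCos T * y) := fun y =>
    ((hcos.mul h1 (RelClose.refl y)).fl h0 h1 hfl).mono h0 h1 (by norm_num)
  have hsm : ∀ y, RelClose u 39 (fl (flSin fl (flTan fl (H i i) (H j j) (H i j)) * y))
      (rotCos T * T * y) := fun y =>
    ((hsin.mul h1 (RelClose.refl y)).fl h0 h1 hfl).mono h0 h1 (by norm_num)
  have htm : RelClose u 39 (fl (H i j * flTan fl (H i i) (H j j) (H i j))) (H i j * T) :=
    (((RelClose.refl _).mul h1 hT).fl h0 h1 hfl).mono h0 h1 (by norm_num)
  have hid : ∀ y, RelClose u 39 y y := fun y => (RelClose.refl y).mono h0 h1 (by norm_num)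
  have bc : ∀ y, |rotCos T * y| ≤ |y| := fun y => by
    rw [abs_mul, abs_of_pos (rotCos_pos T)]
    exact mul_le_of_le_one_left (abs_nonneg y) (rotCos_le_one T)
  have bs : ∀ y, |rotCos T * T * y| ≤ |T| * |y| := fun y => by
    rw [mul_assoc, ← abs_mul]; exact bc _
  constructor
  · ext k l
    simp only [jacobiStep, hc, if_false, transpose_apply, of_apply]
    by_cases a1 : k = i <;> by_cases a2 : k = j <;> by_cases a3 : l = i <;> by_cases a4 : l = j <;>
      simp_all [hs.apply]
  · simp [jacobiStep, hc, hij.symm]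
  · have := (hid (H i i)).abs_fl_sub_sub_le h0 h1 hfl htm hk
    rw [hce] at this
    simpa [jacobiStep, hc] using this
  · have := (hid (H j j)).abs_fl_add_sub_le h0 h1 hfl htm hk
    rw [hce] at this
    simpa [jacobiStep, hc, hij.symm] using this
  · intro k hki hkj
    have := (hcm (H i k)).abs_fl_sub_sub_le h0 h1 hfl (hsm (H j k)) hk
    rw [hce] at this
    have e : jacobiStep fl i j H i k =
        fl (fl (flCos fl (flTan fl (H i i) (H j j) (H i j)) * H i k) -
          fl (flSin fl (flTan fl (H i i) (H j j) (H i j)) * H j k)) := by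
      simp [jacobiStep, hc, hki, hkj]
    rw [e]
    exact this.trans (mul_le_mul_of_nonneg_left (add_le_add (bc _) (bs _)) (by linarith))
  · intro k hki hkj
    have := (hsm (H i k)).abs_fl_add_sub_le h0 h1 hfl (hcm (H j k)) hk
    rw [hce] at this
    have e : jacobiStep fl i j H j k =
        fl (fl (flSin fl (flTan fl (H i i) (H j j) (H i j)) * H i k) +
          fl (flCos fl (flTan fl (H i i) (H j j) (H i j)) * H j k)) := by
      simp [jacobiStep, hc, hki, hkj, hij.symm]
    rw [e]
    exact this.trans (mul_le_mul_of_nonneg_left (add_le_add (bs _) (bc _)) (by linarith))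
  · intro k l hki hkj hli hlj
    simp [jacobiStep, hc, hki, hkj, hli, hlj]

lemma sqrt_diag_mul_abs_le {H : Matrix (Fin n) (Fin n) ℝ} (hH : H.PosDef) (y : Fin n → ℝ)
    (k : Fin n) : Real.sqrt (H k k) * |y k| ≤ Real.sqrt (diagForm H y) := by
  refine Real.le_sqrt_of_sq_le ?_
  rw [mul_pow, sq_abs, Real.sq_sqrt (hH.diag_pos (i := k)).le]
  exact Finset.single_le_sum (f := fun k => H k k * y k ^ 2)
    (fun l _ => mul_nonneg (hH.diag_pos (i := l)).le (sq_nonneg _)) (Finset.mem_univ k)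

lemma eq_planeRot {i j : Fin n} (hij : i ≠ j) {cs sn T : ℝ} (hcT : cs ^ 2 * (1 + T ^ 2) = 1)
    (hsn : sn = cs * T) (x : Fin n → ℝ) :
    x i = cs * (planeRot i j cs sn x i - T * planeRot i j cs sn x j) ∧
      x j = cs * (T * planeRot i j cs sn x i + planeRot i j cs sn x j) := by
  rw [planeRot_left, planeRot_right hij, hsn]
  exact ⟨by linear_combination (-x i) * hcT, by linear_combination (-x j) * hcT⟩

/-- The backward error of a perturbed rotation as a form in the rotated coordinates. -/
lemma IsPerturbedRotation.quadForm_sub_eq {H H' : Matrix (Fin n) (Fin n) ℝ} (hs : H.IsSymm)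
    {i j : Fin n} (hij : i ≠ j) {e T cs sn : ℝ} (hR : IsPerturbedRotation H H' i j T e)
    (hq : H i j * (1 - T ^ 2) = (H j j - H i i) * T) (hcT : cs ^ 2 * (1 + T ^ 2) = 1)
    (hsn : sn = cs * T) (x : Fin n → ℝ) :
    quadForm H' x - quadForm H (planeRot i j cs sn x) =
      (H' i i - (H i i - H i j * T)) * x i ^ 2 + (H' j j - (H j j + H i j * T)) * x j ^ 2 +
      2 * ∑ k ∈ (Finset.univ.erase i).erase j,
        ((H' i k - (cs * H i k - sn * H j k)) * x i * planeRot i j cs sn x k +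
          (H' j k - (sn * H i k + cs * H j k)) * x j * planeRot i j cs sn x k) := by
  obtain ⟨hxi, hxj⟩ := eq_planeRot hij hcT hsn x
  have hyi := planeRot_left (i := i) (j := j) cs sn x
  have hyj := planeRot_right hij cs sn x
  have hyk : ∀ k ∈ (Finset.univ.erase i).erase j, planeRot i j cs sn x k = x k ∧ k ≠ i ∧ k ≠ j := by
    intro k hk
    simp only [Finset.mem_erase] at hk
    exact ⟨planeRot_of_ne _ _ _ hk.2.1 hk.1, hk.2.1, hk.1⟩
  generalize planeRot i j cs sn x = y at *
  -- the exact rotation diagonalizes the pivot block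
  have hblock : H i i * y i ^ 2 + H j j * y j ^ 2 + 2 * H i j * y i * y j =
      (H i i - H i j * T) * x i ^ 2 + (H j j + H i j * T) * x j ^ 2 := by
    rw [hxi, hxj]
    linear_combination (-(H i i * y i ^ 2 + H j j * y j ^ 2 + 2 * H i j * y i * y j)) * hcT +
      cs ^ 2 * (2 * y i * y j + T * y i ^ 2 - T * y j ^ 2) * hq
  rw [quadForm_eq_pair_add hij x hR.symm, quadForm_eq_pair_add hij y hs, hblock, hR.pivot]
  generalize (Finset.univ.erase i).erase j = S at *
  have e1 : ∑ k ∈ S, ∑ l ∈ S, H' k l * x k * x l = ∑ k ∈ S, ∑ l ∈ S, H k l * y k * y l :=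
    Finset.sum_congr rfl fun k hk => Finset.sum_congr rfl fun l hl => by
      rw [hR.rest k l (hyk k hk).2.1 (hyk k hk).2.2 (hyk l hl).2.1 (hyk l hl).2.2,
        (hyk k hk).1, (hyk l hl).1]
  have e2 : ∑ k ∈ S, (H' i k * x i + H' j k * x j) * x k -
      ∑ k ∈ S, (H i k * y i + H j k * y j) * y k =
      ∑ k ∈ S, ((H' i k - (cs * H i k - sn * H j k)) * x i * y k +
      (H' j k - (sn * H i k + cs * H j k)) * x j * y k) := by
    rw [← Finset.sum_sub_distrib]
    refine Finset.sum_congr rfl fun k hk => ?_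
    rw [(hyk k hk).1, hyi, hyj]
    ring
  rw [e1, ← e2]
  ring

/-- The estimates of the tangent, of one diagonal error and of one coordinate in a rotation, where
`p ^ 2` and `q ^ 2` are the two diagonal entries. -/
lemma rotation_scale_bounds {p q T c ξ a b cs w : ℝ} (hp0 : 0 ≤ p) (hq0 : 0 ≤ q)
    (hcpq : |c| ≤ p * q) (hTp : T ^ 2 * p ^ 2 ≤ 4 * q ^ 2) (hTq : T ^ 2 * q ^ 2 ≤ 4 * p ^ 2)
    (hcs1 : cs ≤ 1) (ha : p * |a| ≤ w) (hb : q * |b| ≤ w)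
    (hξ : |ξ| ≤ cs * (|a| + |T| * |b|)) :
    |T| * q ≤ 2 * p ∧ p ^ 2 + |c * T| ≤ 3 * p ^ 2 ∧ p * |ξ| ≤ 3 * w := by
  have hTp' : |T| * p ≤ 2 * q := by
    refine abs_le_of_sq_le_sq' ?_ (by positivity) |>.2
    rw [mul_pow, mul_pow, sq_abs]; linarith
  have hTq' : |T| * q ≤ 2 * p := by
    refine abs_le_of_sq_le_sq' ?_ (by positivity) |>.2
    rw [mul_pow, mul_pow, sq_abs]; linarith
  refine ⟨hTq', ?_, ?_⟩
  · have h2 : |c| * |T| ≤ 2 * p ^ 2 :=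
      calc |c| * |T| ≤ p * q * |T| := by gcongr
        _ = p * (|T| * q) := by ring
        _ ≤ p * (2 * p) := by gcongr
        _ = 2 * p ^ 2 := by ring
    rw [abs_mul]
    linarith
  · calc p * |ξ| ≤ p * (1 * (|a| + |T| * |b|)) := by
          refine mul_le_mul_of_nonneg_left (hξ.trans ?_) hp0
          gcongr
      _ = p * |a| + (|T| * p) * |b| := by ring
      _ ≤ w + (2 * q) * |b| := by gcongr
      _ ≤ 3 * w := by linarith

/-- The backward error of a rotation, measured in the scaling of the matrix it is applied to. The
bound has no dimensional factor, and grading of the diagonal does no harm because the tangent is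
small between entries of different size (`rotTan_sq_mul_le`). -/
lemma IsPerturbedRotation.abs_quadForm_sub_le {H H' : Matrix (Fin n) (Fin n) ℝ} (hH : H.PosDef)
    {i j : Fin n} (hij : i ≠ j) (hc : H i j ≠ 0) {e : ℝ} (he : 0 ≤ e)
    (hR : IsPerturbedRotation H H' i j (rotTan (H i i) (H j j) (H i j)) e) {L : ℝ} (hL : 1 ≤ L)
    (hup : ∀ x, quadForm H x ≤ L * diagForm H x) {cs sn : ℝ}
    (hcs : cs = rotCos (rotTan (H i i) (H j j) (H i j)))
    (hsn : sn = cs * rotTan (H i i) (H j j) (H i j)) (x : Fin n → ℝ) :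
    |quadForm H' x - quadForm H (planeRot i j cs sn x)| ≤
      90 * e * L * diagForm H (planeRot i j cs sn x) := by
  have ha := hH.diag_pos (i := i)
  have hb := hH.diag_pos (i := j)
  obtain ⟨hTa, hTb⟩ := rotTan_sq_mul_le ha hb hc (entry_sq_le hH i j)
  have hq := rotTan_quadratic (H i i) (H j j) hc
  generalize rotTan (H i i) (H j j) (H i j) = T at *
  have hcs0 : 0 < cs := hcs ▸ rotCos_pos T
  have hcs1 : cs ≤ 1 := hcs ▸ rotCos_le_one T
  have hcT : cs ^ 2 * (1 + T ^ 2) = 1 := hcs ▸ rotCos_sq T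
  rw [hR.quadForm_sub_eq (posDef_iff_quadForm.1 hH).1 hij hq hcT hsn]
  obtain ⟨hxi, hxj⟩ := eq_planeRot hij hcT hsn x
  obtain ⟨-, -, hd1, hd2, hr1, hr2, -⟩ := hR
  simp only [← hcs, ← hsn] at hr1 hr2
  generalize planeRot i j cs sn x = y at *
  have hS : ∀ k ∈ (Finset.univ.erase i).erase j, k ≠ i ∧ k ≠ j := fun k hk => by
    simp only [Finset.mem_erase] at hk
    exact ⟨hk.2.1, hk.1⟩
  have hsub : ∀ i', ∑ k ∈ (Finset.univ.erase i).erase j, |H i' k| * |y k| ≤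
      Real.sqrt (H i' i') * Real.sqrt (L * diagForm H y) := fun i' =>
    (Finset.sum_le_sum_of_subset_of_nonneg (Finset.subset_univ _)
      fun _ _ _ => by positivity).trans (sum_abs_row_le hH (by linarith) hup i' y)
  have hRi := hsub i
  have hRj := hsub j
  have hyi := sqrt_diag_mul_abs_le hH y i
  have hyj := sqrt_diag_mul_abs_le hH y j
  have hN0 : 0 ≤ diagForm H y := diagForm_nonneg hH y
  have hcpq : |H i j| ≤ Real.sqrt (H i i) * Real.sqrt (H j j) := by
    rw [← Real.sqrt_mul ha.le]
    exact Real.abs_le_sqrt (entry_sq_le hH i j)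
  have hp2 := Real.sq_sqrt ha.le
  have hq2 := Real.sq_sqrt hb.le
  have hw2 := Real.sq_sqrt hN0
  have hp0 := Real.sqrt_nonneg (H i i)
  have hq0 := Real.sqrt_nonneg (H j j)
  have hρ0 := Real.sqrt_nonneg (L * diagForm H y)
  have hρ2 := Real.mul_self_sqrt (show 0 ≤ L * diagForm H y by positivity)
  have hwρ : Real.sqrt (diagForm H y) ≤ Real.sqrt (L * diagForm H y) :=
    Real.sqrt_le_sqrt (by nlinarith)
  generalize Real.sqrt (H i i) = p at *
  generalize Real.sqrt (H j j) = q at *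
  generalize Real.sqrt (L * diagForm H y) = ρ at *
  generalize Real.sqrt (diagForm H y) = w at *
  generalize diagForm H y = N at *
  generalize (Finset.univ.erase i).erase j = S at *
  obtain ⟨hTq, hDi, hpx⟩ := rotation_scale_bounds (ξ := x i) (a := y i) (b := y j) (T := T) hp0 hq0
    hcpq (by rw [hp2, hq2]; exact hTa) (by rw [hp2, hq2]; exact hTb) hcs1 hyi hyj (by
      rw [hxi, abs_mul, abs_of_pos hcs0, ← abs_mul]
      gcongr
      exact abs_sub _ _)
  obtain ⟨hTp, hDj, hqx⟩ := rotation_scale_bounds (ξ := x j) (a := y j) (b := y i) (T := T) hq0 hp0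
    (by rwa [mul_comm]) (by rw [hp2, hq2]; exact hTb) (by rw [hp2, hq2]; exact hTa) hcs1 hyj
    hyi (by
      rw [hxj, abs_mul, abs_of_pos hcs0, ← abs_mul, add_comm |y j|]
      gcongr
      exact abs_add_le _ _)
  rw [hp2] at hDi
  rw [hq2] at hDj
  -- either diagonal error, with `m ^ 2` the diagonal entry and `ξ` the coordinate it belongs to
  have hdiag : ∀ {D s ξ m : ℝ}, |D| ≤ e * s → s ≤ 3 * m ^ 2 → m * |ξ| ≤ 3 * w → 0 ≤ m →
      |D * ξ ^ 2| ≤ 27 * e * N := fun {D s ξ m} h1 h2 h3 hm =>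
    calc |D * ξ ^ 2| = |D| * ξ ^ 2 := by rw [abs_mul, abs_of_nonneg (sq_nonneg ξ)]
      _ ≤ e * (3 * m ^ 2) * ξ ^ 2 := by
          have := h1.trans (mul_le_mul_of_nonneg_left h2 he)
          gcongr
      _ = 3 * e * (m * |ξ|) ^ 2 := by rw [mul_pow, sq_abs]; ring
      _ ≤ 3 * e * (3 * w) ^ 2 := by gcongr
      _ = 27 * e * N := by rw [← hw2]; ring
  have hD1 := hdiag hd1 (by rw [abs_of_pos ha, hp2]; exact hDi) hpx hp0
  have hD2 := hdiag hd2 (by rw [abs_of_pos hb, hq2]; exact hDj) hqx hq0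
  have hrow : |∑ k ∈ S, ((H' i k - (cs * H i k - sn * H j k)) * x i * y k +
        (H' j k - (sn * H i k + cs * H j k)) * x j * y k)| ≤ 18 * e * (w * ρ) := by
    calc _ ≤ ∑ k ∈ S, (e * (|H i k| + |T| * |H j k|) * |x i| * |y k| +
          e * (|T| * |H i k| + |H j k|) * |x j| * |y k|) := by
          refine (Finset.abs_sum_le_sum_abs _ _).trans (Finset.sum_le_sum fun k hk => ?_)
          refine (abs_add_le _ _).trans ?_
          rw [abs_mul, abs_mul, abs_mul, abs_mul]
          have := hr1 k (hS k hk).1 (hS k hk).2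
          have := hr2 k (hS k hk).1 (hS k hk).2
          gcongr
      _ = e * |x i| * (∑ k ∈ S, |H i k| * |y k| + |T| * ∑ k ∈ S, |H j k| * |y k|) +
          e * |x j| * (|T| * ∑ k ∈ S, |H i k| * |y k| + ∑ k ∈ S, |H j k| * |y k|) := by
          simp only [Finset.mul_sum, ← Finset.sum_add_distrib]
          exact Finset.sum_congr rfl fun k _ => by ring
      _ ≤ e * |x i| * (p * ρ + |T| * (q * ρ)) + e * |x j| * (|T| * (p * ρ) + q * ρ) := by
          gcongr
      _ = e * ρ * (|x i| * (p + |T| * q) + |x j| * (|T| * p + q)) := by ring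
      _ ≤ e * ρ * (|x i| * (p + 2 * p) + |x j| * (2 * q + q)) := by gcongr
      _ = e * ρ * (3 * (p * |x i|) + 3 * (q * |x j|)) := by ring
      _ ≤ e * ρ * (3 * (3 * w) + 3 * (3 * w)) := by gcongr
      _ = 18 * e * (w * ρ) := by ring
  have hwρ' : w * ρ ≤ L * N := hρ2 ▸ mul_le_mul_of_nonneg_right hwρ hρ0
  have hNL : N ≤ L * N := le_mul_of_one_le_left hN0 hL
  refine (abs_add_le _ _).trans ((add_le_add ((abs_add_le _ _).trans (add_le_add hD1 hD2))
    (le_of_eq (abs_mul _ _))).trans ?_)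
  rw [abs_two]
  linarith [mul_le_mul_of_nonneg_left hwρ' he, mul_le_mul_of_nonneg_left hNL he]

/-- One computed rotation changes every eigenvalue by a relative error `O(u)` times the scaled
condition number of the matrix it is applied to. -/
theorem jacobiStep_factorClose {u : ℝ} {fl : ℝ → ℝ} (h0 : 0 ≤ u) (hu : 80 * u ≤ 1)
    (hfl : IsRounding u fl) {H : Matrix (Fin n) (Fin n) ℝ} (hH : H.PosDef) {i j : Fin n}
    (hij : i ≠ j) {κ : ℝ} (hκ : scaledCond H ≤ κ) (hη : 7200 * u * κ < 1) :
    (jacobiStep fl i j H).PosDef ∧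
      FactorClose (1 - 7200 * u * κ) (lam H) (lam (jacobiStep fl i j H)) := by
  have hs := (posDef_iff_quadForm.1 hH).1
  obtain ⟨l, L, hl, hL, -, hc, hb⟩ := exists_scaledCond_eq i.pos hH
  have hκ0 : 0 ≤ κ := le_trans (by rw [hc]; positivity) hκ
  by_cases hz : H i j = 0
  · have e : jacobiStep fl i j H = H := by simp [jacobiStep, hz]
    rw [e]
    refine ⟨hH, fun k => ?_⟩
    have := lam_pos hH k
    have h2 : 0 ≤ 7200 * u * κ := by positivity
    constructor <;> nlinarith
  set cs := rotCos (rotTan (H i i) (H j j) (H i j)) with hcs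
  set sn := cs * rotTan (H i i) (H j j) (H i j) with hsn
  have hsq : cs ^ 2 + sn ^ 2 = 1 := by
    have := rotCos_sq (rotTan (H i i) (H j j) (H i j))
    rw [← hcs] at this
    rw [hsn]
    linear_combination this
  have hR := isPerturbedRotation_jacobiStep h0 hu hfl hs hij hz
  refine factorClose_of_quadForm hH hR.symm (isOrderedSpectrum_lam hs)
    (isOrderedSpectrum_lam hR.symm) (planeRot i j cs sn) (planeRot i j cs (-sn))
    (fun x => planeRot_dotProduct_self hij cs sn x hsq)
    (fun x => planeRot_planeRot_neg hij cs sn x hsq) hη fun x => ?_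
  refine (hR.abs_quadForm_sub_le hH hij hz (by positivity) hL (fun x => (hb x).2) hcs hsn
    x).trans ?_
  set y := planeRot i j cs sn x
  have hN : L * diagForm H y ≤ κ * quadForm H y := by
    have h1 : diagForm H y ≤ quadForm H y / l := by
      rw [le_div_iff₀ hl, mul_comm]; exact (hb y).1
    calc L * diagForm H y ≤ L * (quadForm H y / l) := by gcongr
      _ = scaledCond H * quadForm H y := by rw [hc]; ring
      _ ≤ κ * quadForm H y := mul_le_mul_of_nonneg_right hκ (quadForm_nonneg hH y)
  calc 90 * (80 * u) * L * diagForm H y = 7200 * u * (L * diagForm H y) := by ring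
    _ ≤ 7200 * u * (κ * quadForm H y) := by gcongr
    _ = 7200 * u * κ * quadForm H y := by ring

lemma jacobiIter_cons (fl : ℝ → ℝ) (H : Matrix (Fin n) (Fin n) ℝ) (p : Fin n × Fin n)
    (ps : List (Fin n × Fin n)) :
    jacobiIter fl H (p :: ps) = jacobiIter fl (jacobiStep fl p.1 p.2 H) ps := rfl

theorem jacobiIter_factorClose {u : ℝ} {fl : ℝ → ℝ} (h0 : 0 ≤ u) (hu : 80 * u ≤ 1)
    (hfl : IsRounding u fl) {κ : ℝ} (hη : 7200 * u * κ < 1) (pivots : List (Fin n × Fin n))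
    (hp : ∀ p ∈ pivots, p.1 ≠ p.2) {H : Matrix (Fin n) (Fin n) ℝ} (hH : H.PosDef)
    (hκ : ∀ m < pivots.length, scaledCond (jacobiIter fl H (pivots.take m)) ≤ κ) :
    (jacobiIter fl H pivots).PosDef ∧
      FactorClose ((1 - 7200 * u * κ) ^ pivots.length) (lam H) (lam (jacobiIter fl H pivots)) := by
  induction pivots generalizing H with
  | nil => exact ⟨hH, fun k => by simp [jacobiIter]⟩
  | cons p ps ih =>
    obtain ⟨hH', hF⟩ := jacobiStep_factorClose h0 hu hfl hH (hp p (by simp))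
      (hκ 0 (by simp)) hη
    obtain ⟨hH'', hF'⟩ := ih (fun q hq => hp q (by simp [hq])) hH'
      (fun m hm => by simpa [jacobiIter_cons] using hκ (m + 1) (by simpa using hm))
    rw [jacobiIter_cons]
    refine ⟨hH'', ?_⟩
    rw [List.length_cons, pow_succ']
    exact hF.trans (by linarith) (pow_nonneg (by linarith) _) hF'

/-! ### The stopping criterion -/

lemma sum_sqrt_mul_abs_sq_le {H : Matrix (Fin n) (Fin n) ℝ} (hd : ∀ i, 0 ≤ H i i)
    (x : Fin n → ℝ) : (∑ i, Real.sqrt (H i i) * |x i|) ^ 2 ≤ n * diagForm H x := by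
  have := sq_sum_le_card_mul_sum_sq (s := Finset.univ) (f := fun i => Real.sqrt (H i i) * |x i|)
  simp only [mul_pow, sq_abs, Real.sq_sqrt (hd _), Finset.card_univ, Fintype.card_fin] at this
  exact this

lemma abs_quadForm_sub_le_of_entry {A B E : Matrix (Fin n) (Fin n) ℝ}
    (h : ∀ i j, |B i j - A i j| ≤ E i j) (x : Fin n → ℝ) :
    |quadForm B x - quadForm A x| ≤ ∑ i, ∑ j, E i j * |x i| * |x j| := by
  rw [← quadForm_sub, quadForm_eq_sum]
  refine (Finset.abs_sum_le_sum_abs _ _).trans (Finset.sum_le_sum fun i _ => ?_)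
  refine (Finset.abs_sum_le_sum_abs _ _).trans (Finset.sum_le_sum fun j _ => ?_)
  rw [abs_mul, abs_mul, Matrix.sub_apply]
  have := h i j
  gcongr

lemma sum_sum_mul_eq_sq (v : Fin n → ℝ) : ∑ i, ∑ j, v i * v j = (∑ i, v i) ^ 2 := by
  rw [sq, Finset.sum_mul_sum]

theorem stopCriterion_factorClose {tol : ℝ} (ht : 0 ≤ tol) (hnt : n * tol < 1)
    {H : Matrix (Fin n) (Fin n) ℝ} (hH : H.PosDef) (hcrit : StopCriterion tol H) :
    FactorClose (1 - n * tol) (kthLargest fun i => H i i) (lam H) := by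
  have hd : (diagonal fun i => H i i).PosDef :=
    PosDef.diagonal fun i => hH.diag_pos (i := i)
  have hs := (posDef_iff_quadForm.1 hH).1
  refine (factorClose_of_quadForm hd hs (isOrderedSpectrum_diagonal _)
    (isOrderedSpectrum_lam hs) LinearMap.id LinearMap.id (fun _ => rfl) (fun _ => rfl) hnt
    fun x => ?_).2
  have hdx : quadForm (diagonal fun i => H i i) x = diagForm H x := quadForm_diagonal _ _
  have h := abs_quadForm_sub_le_of_entry (A := diagonal fun i => H i i) (B := H)
    (E := of fun i j => tol * (Real.sqrt (H i i) * Real.sqrt (H j j))) (fun i j => by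
      rcases eq_or_ne i j with rfl | hij
      · simp only [diagonal_apply_eq, sub_self, abs_zero, of_apply]; positivity
      · rw [diagonal_apply_ne _ hij, sub_zero, of_apply,
          ← Real.sqrt_mul (hH.diag_pos (i := i)).le]
        exact hcrit i j hij) x
  refine h.trans ?_
  have e : ∑ i, ∑ j, (of fun i j => tol * (Real.sqrt (H i i) * Real.sqrt (H j j))) i j *
      |x i| * |x j| = tol * (∑ i, Real.sqrt (H i i) * |x i|) ^ 2 := by
    rw [← sum_sum_mul_eq_sq, Finset.mul_sum]
    refine Finset.sum_congr rfl fun i _ => ?_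
    rw [Finset.mul_sum]
    exact Finset.sum_congr rfl fun j _ => by rw [of_apply]; ring
  rw [e]
  simp only [LinearMap.id_apply, hdx]
  have := mul_le_mul_of_nonneg_left
    (sum_sqrt_mul_abs_sq_le (fun i => (hH.diag_pos (i := i)).le) x) ht
  linarith

/-! ### Floating-point matrix products -/

/-- With `r = (1 - u)⁻¹`, a sum of `m` terms in any order has an error of at most `r ^ m - 1`
relative to the sum of the absolute values. -/
lemma FlSum.abs_sub_sum_le {u r : ℝ} {fl : ℝ → ℝ} (hr : 1 ≤ r) (hur : u ≤ r - 1)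
    (hfl : IsRounding u fl) {s : Multiset ℝ} {x : ℝ} (h : FlSum fl s x) :
    0 < s.card ∧ |x - s.sum| ≤ (r ^ s.card - 1) * (s.map abs).sum := by
  induction h with
  | single a =>
    refine ⟨by simp, ?_⟩
    simpa using mul_nonneg (sub_nonneg.2 hr) (abs_nonneg a)
  | add s t x y _ _ ihs iht =>
    obtain ⟨hs0, hs⟩ := ihs
    obtain ⟨ht0, ht⟩ := iht
    refine ⟨by simp [hs0], ?_⟩
    rw [Multiset.sum_add, Multiset.map_add, Multiset.sum_add, Multiset.card_add]
    obtain ⟨m, hm⟩ : ∃ m, s.card + t.card = m + 1 := ⟨s.card + t.card - 1, by omega⟩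
    have hsA : 0 ≤ (s.map abs).sum := (abs_nonneg _).trans (Multiset.abs_sum_le_sum_abs (s := s))
    have htA : 0 ≤ (t.map abs).sum := (abs_nonneg _).trans (Multiset.abs_sum_le_sum_abs (s := t))
    have hsum : |s.sum + t.sum| ≤ (s.map abs).sum + (t.map abs).sum :=
      (abs_add_le _ _).trans
        (add_le_add Multiset.abs_sum_le_sum_abs Multiset.abs_sum_le_sum_abs)
    have hsm : r ^ s.card ≤ r ^ m := pow_le_pow_right₀ hr (by omega)
    have htm : r ^ t.card ≤ r ^ m := pow_le_pow_right₀ hr (by omega)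
    have hd : |x + y - (s.sum + t.sum)| ≤ (r ^ m - 1) * ((s.map abs).sum + (t.map abs).sum) := by
      rw [add_sub_add_comm, mul_add]
      exact (abs_add_le _ _).trans (add_le_add
        (hs.trans (mul_le_mul_of_nonneg_right (by linarith) hsA))
        (ht.trans (mul_le_mul_of_nonneg_right (by linarith) htA)))
    have hf : |fl (x + y) - (x + y)| ≤ (r - 1) * |x + y| :=
      (hfl _).trans (mul_le_mul_of_nonneg_right hur (abs_nonneg _))
    have hxy : |x + y| ≤ |s.sum + t.sum| + |x + y - (s.sum + t.sum)| := by
      have := abs_add_le (s.sum + t.sum) (x + y - (s.sum + t.sum))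
      rwa [add_sub_cancel] at this
    rw [hm, pow_succ]
    calc |fl (x + y) - (s.sum + t.sum)|
        ≤ |fl (x + y) - (x + y)| + |x + y - (s.sum + t.sum)| := abs_sub_le _ _ _
      _ ≤ (r - 1) * ((s.map abs).sum + (t.map abs).sum +
            (r ^ m - 1) * ((s.map abs).sum + (t.map abs).sum)) +
            (r ^ m - 1) * ((s.map abs).sum + (t.map abs).sum) := by
          refine add_le_add (hf.trans (mul_le_mul_of_nonneg_left ?_ (by linarith))) hd
          linarith
      _ = (r ^ m * r - 1) * ((s.map abs).sum + (t.map abs).sum) := by ring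

lemma IsFlMul.abs_sub_le {u r : ℝ} {fl : ℝ → ℝ} (hr : 1 ≤ r) (hur : u ≤ r - 1)
    (hfl : IsRounding u fl) {A B C : Matrix (Fin n) (Fin n) ℝ} (h : IsFlMul fl A B C)
    (i j : Fin n) : |C i j - (A * B) i j| ≤ (r ^ (n + 1) - 1) * ∑ k, |A i k| * |B k j| := by
  have h1 := ((h i j).abs_sub_sum_le hr hur hfl).2
  simp only [Multiset.map_map, Multiset.card_map, Finset.card_val, Finset.card_univ,
    Fintype.card_fin, Function.comp_def] at h1
  change |C i j - ∑ k, fl (A i k * B k j)| ≤ (r ^ n - 1) * ∑ k, |fl (A i k * B k j)| at h1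
  have hrn : 1 ≤ r ^ n := one_le_pow₀ hr
  have hf : ∀ k, |fl (A i k * B k j) - A i k * B k j| ≤ (r - 1) * (|A i k| * |B k j|) := fun k => by
    rw [← abs_mul]
    exact (hfl _).trans (mul_le_mul_of_nonneg_right hur (abs_nonneg _))
  have h2 : |∑ k, fl (A i k * B k j) - (A * B) i j| ≤ (r - 1) * ∑ k, |A i k| * |B k j| := by
    rw [mul_apply, ← Finset.sum_sub_distrib, Finset.mul_sum]
    exact (Finset.abs_sum_le_sum_abs _ _).trans (Finset.sum_le_sum fun k _ => hf k)
  have h3 : ∑ k, |fl (A i k * B k j)| ≤ r * ∑ k, |A i k| * |B k j| := by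
    rw [Finset.mul_sum]
    refine Finset.sum_le_sum fun k _ => ?_
    have := abs_add_le (A i k * B k j) (fl (A i k * B k j) - A i k * B k j)
    rw [add_sub_cancel, abs_mul] at this
    linarith [hf k]
  calc _ ≤ |C i j - ∑ k, fl (A i k * B k j)| + |∑ k, fl (A i k * B k j) - (A * B) i j| :=
        _root_.abs_sub_le _ _ _
    _ ≤ (r ^ n - 1) * (r * ∑ k, |A i k| * |B k j|) + (r - 1) * ∑ k, |A i k| * |B k j| :=
        add_le_add (h1.trans (mul_le_mul_of_nonneg_left h3 (by linarith))) h2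
    _ = _ := by ring

lemma inv_one_sub_pow_le {u : ℝ} (h0 : 0 ≤ u) (hn : 0 < n) (hu : 4 * n * u ≤ 1) :
    ((1 - u)⁻¹) ^ (n + 1) - 1 ≤ 4 * n * u := by
  have hn1 : (1 : ℝ) ≤ n := by exact_mod_cast hn
  have hun : u ≤ n * u := le_mul_of_one_le_left h0 hn1
  have hb : 1 - (n + 1) * u ≤ (1 - u) ^ (n + 1) := by
    have := one_add_mul_le_pow (a := -u) (by linarith) (n + 1)
    rw [← sub_eq_add_neg] at this
    push_cast at this
    linarith
  have hp : 0 < 1 - (n + 1) * u := by linarith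
  have : ((1 - u)⁻¹) ^ (n + 1) ≤ (1 - (n + 1) * u)⁻¹ := by
    rw [inv_pow]; exact inv_anti₀ hp hb
  refine (sub_le_sub_right this 1).trans ?_
  rw [sub_le_iff_le_add, inv_le_iff_one_le_mul₀ hp]
  have h2 : 1 - 2 * (n * u) ≤ 1 - (n + 1) * u := by linarith
  nlinarith [mul_nonneg (Nat.cast_nonneg (α := ℝ) n) h0]

lemma abs_entry_le {A : Matrix (Fin n) (Fin n) ℝ} (hA : A.PosDef) {L : ℝ}
    (hup : ∀ x, quadForm A x ≤ L * (x ⬝ᵥ x)) (i j : Fin n) : |A i j| ≤ L := by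
  have hd : ∀ i, A i i ≤ L := fun i => by
    simpa [quadForm_single] using hup (Pi.single i 1)
  have hi := hA.diag_pos (i := i)
  have hj := hA.diag_pos (i := j)
  refine abs_le_of_sq_le_sq ((entry_sq_le hA i j).trans ?_) (by linarith [hd i])
  nlinarith [hd i, hd j]

/-- The error of the computed triple product, entry by entry. The columns of `Q` have norm at most
`√2`, hence absolute sums at most `√(2 n)`. -/
lemma abs_flTriple_sub_le {u r δ : ℝ} {fl : ℝ → ℝ} (hr : 1 ≤ r) (hur : u ≤ r - 1)
    (hδ : r ^ (n + 1) - 1 = δ) (hδ1 : δ ≤ 1)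
    (hfl : IsRounding u fl) {A Q P B : Matrix (Fin n) (Fin n) ℝ} (hP : IsFlMul fl Qᵀ A P)
    (hB : IsFlMul fl P Q B) {L : ℝ} (hAL : ∀ i j, |A i j| ≤ L)
    (hQ : ∀ i, ∑ k, Q k i ^ 2 ≤ 2) (i j : Fin n) :
    |B i j - (Qᵀ * A * Q) i j| ≤ 6 * n * δ * L := by
  have hδ0 : 0 ≤ δ := by rw [← hδ]; linarith [one_le_pow₀ (n := n + 1) hr]
  have h1 : ∀ l, |P i l - (Qᵀ * A) i l| ≤ δ * ∑ k, |Q k i| * |A k l| := fun l => by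
    rw [← hδ]; exact hP.abs_sub_le hr hur hfl i l
  have h2 : |B i j - (P * Q) i j| ≤ δ * ∑ l, |P i l| * |Q l j| := by
    rw [← hδ]; exact hB.abs_sub_le hr hur hfl i j
  have hL : 0 ≤ L := (abs_nonneg _).trans (hAL i i)
  have hcol : ∀ i, (∑ k, |Q k i|) ^ 2 ≤ 2 * n := fun i => by
    have := sq_sum_le_card_mul_sum_sq (s := Finset.univ) (f := fun k => |Q k i|)
    simp only [sq_abs, Finset.card_univ, Fintype.card_fin] at this
    nlinarith [hQ i, Nat.cast_nonneg (α := ℝ) n]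
  have hcc : (∑ k, |Q k i|) * ∑ l, |Q l j| ≤ 2 * n := by
    nlinarith [hcol i, hcol j, sq_nonneg (∑ k, |Q k i| - ∑ l, |Q l j|)]
  have h3 : ∀ l, ∑ k, |Q k i| * |A k l| ≤ L * ∑ k, |Q k i| := fun l => by
    rw [Finset.mul_sum]
    refine Finset.sum_le_sum fun k _ => ?_
    rw [mul_comm]
    exact mul_le_mul_of_nonneg_right (hAL k l) (abs_nonneg _)
  have h4 : ∀ l, |P i l| ≤ 2 * (L * ∑ k, |Q k i|) := fun l => by
    have e : |(Qᵀ * A) i l| ≤ ∑ k, |Q k i| * |A k l| := by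
      rw [mul_apply]
      refine (Finset.abs_sum_le_sum_abs _ _).trans (le_of_eq ?_)
      exact Finset.sum_congr rfl fun k _ => abs_mul _ _
    have := abs_add_le ((Qᵀ * A) i l) (P i l - (Qᵀ * A) i l)
    rw [add_sub_cancel] at this
    have h0 : 0 ≤ ∑ k, |Q k i| * |A k l| := (abs_nonneg _).trans e
    nlinarith [h1 l, h3 l]
  have h5 : |(P * Q) i j - (Qᵀ * A * Q) i j| ≤ δ * (L * ∑ k, |Q k i|) * ∑ l, |Q l j| := by
    rw [mul_apply, mul_apply, ← Finset.sum_sub_distrib, Finset.mul_sum]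
    refine (Finset.abs_sum_le_sum_abs _ _).trans (Finset.sum_le_sum fun l _ => ?_)
    rw [← sub_mul, abs_mul]
    exact mul_le_mul_of_nonneg_right
      ((h1 l).trans (mul_le_mul_of_nonneg_left (h3 l) hδ0)) (abs_nonneg _)
  have h6 : ∑ l, |P i l| * |Q l j| ≤ 2 * (L * ∑ k, |Q k i|) * ∑ l, |Q l j| := by
    rw [Finset.mul_sum]
    exact Finset.sum_le_sum fun l _ => mul_le_mul_of_nonneg_right (h4 l) (abs_nonneg _)
  calc _ ≤ |B i j - (P * Q) i j| + |(P * Q) i j - (Qᵀ * A * Q) i j| := _root_.abs_sub_le _ _ _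
    _ ≤ δ * (2 * (L * ∑ k, |Q k i|) * ∑ l, |Q l j|) +
        δ * (L * ∑ k, |Q k i|) * ∑ l, |Q l j| :=
        add_le_add (h2.trans (mul_le_mul_of_nonneg_left h6 hδ0)) h5
    _ = 3 * δ * L * ((∑ k, |Q k i|) * ∑ l, |Q l j|) := by ring
    _ ≤ 3 * δ * L * (2 * n) := by gcongr
    _ = 6 * n * δ * L := by ring

/-! ### Demotion and symmetrization -/

lemma isSymm_flSymPart (fl : ℝ → ℝ) (B : Matrix (Fin n) (Fin n) ℝ) : (flSymPart fl B).IsSymm := by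
  ext i j
  simp [flSymPart, add_comm]

/-- Demotion to precision `u` and symmetrization add an error of `4 u` relative to the entry. -/
lemma abs_demoted_sub_le {u f : ℝ} {fl : ℝ → ℝ} (h0 : 0 ≤ u) (hu : u ≤ 1 / 10)
    (hfl : IsRounding u fl) {B C M : Matrix (Fin n) (Fin n) ℝ} (hM : M.IsSymm)
    (hB : ∀ i j, |B i j - M i j| ≤ f)
    (hC : C = B.map fl ∨ C = flSymPart fl (B.map fl)) (i j : Fin n) :
    |C i j - M i j| ≤ 4 * u * |M i j| + 3 * f := by
  have hf : 0 ≤ f := (abs_nonneg _).trans (hB i j)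
  have key : ∀ x y e : ℝ, |x - y| ≤ e → |fl x - y| ≤ e + u * (|y| + e) := by
    intro x y e h
    have h1 := hfl x
    have h2 : |x| ≤ |y| + e := by
      have := abs_add_le y (x - y)
      rw [add_sub_cancel] at this
      linarith
    calc |fl x - y| ≤ |fl x - x| + |x - y| := _root_.abs_sub_le _ _ _
      _ ≤ u * (|y| + e) + e := add_le_add (h1.trans (mul_le_mul_of_nonneg_left h2 h0)) h
      _ = _ := add_comm _ _
  have hm := abs_nonneg (M i j)
  have hum : 0 ≤ u * |M i j| := mul_nonneg h0 hm
  have huf : u * f ≤ 1 / 10 * f := mul_le_mul_of_nonneg_right hu hf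
  have hentry : ∀ i j, |fl (B i j) - M i j| ≤ f + u * (|M i j| + f) := fun i j => key _ _ _ (hB i j)
  rcases hC with rfl | rfl
  · rw [map_apply]
    linarith [hentry i j]
  · simp only [flSymPart, of_apply, map_apply]
    have e1 := hentry i j
    have e2 := hentry j i
    rw [hM.apply i j] at e2
    have e3 : |fl (B i j) + fl (B j i) - 2 * M i j| ≤ 2 * (u * |M i j| + 11 / 10 * f) := by
      rw [show fl (B i j) + fl (B j i) - 2 * M i j =
        (fl (B i j) - M i j) + (fl (B j i) - M i j) by ring]
      refine (abs_add_le _ _).trans ?_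
      linarith
    have e4 := key _ _ _ e3
    rw [abs_mul, abs_two] at e4
    have huu : u * (u * |M i j|) ≤ 1 / 10 * (u * |M i j|) := mul_le_mul_of_nonneg_right hu hum
    have e5 : |fl (fl (B i j) + fl (B j i)) / 2 - M i j| ≤
        22 / 10 * (u * |M i j|) + 13 / 10 * f := by
      rw [show fl (fl (B i j) + fl (B j i)) / 2 - M i j =
        (fl (fl (B i j) + fl (B j i)) - 2 * M i j) / 2 by ring, abs_div, abs_two]
      linarith
    have e6 := key _ _ _ e5
    linarith

/-- Quadratic form error of an entrywise perturbation. -/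
lemma abs_quadForm_sub_le_of_demoted {M C : Matrix (Fin n) (Fin n) ℝ} (hM : M.PosDef)
    {a b : ℝ} (ha : 0 ≤ a) (hb : 0 ≤ b) (h : ∀ i j, |C i j - M i j| ≤ a * |M i j| + b)
    (x : Fin n → ℝ) :
    |quadForm C x - quadForm M x| ≤ a * (n * diagForm M x) + b * (n * (x ⬝ᵥ x)) := by
  have hE : ∀ i j, |C i j - M i j| ≤
      (of fun i j => a * (Real.sqrt (M i i) * Real.sqrt (M j j)) + b) i j := fun i j => by
    refine (h i j).trans ?_
    rw [of_apply, ← Real.sqrt_mul (hM.diag_pos (i := i)).le]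
    have := Real.abs_le_sqrt (entry_sq_le hM i j)
    gcongr
  refine (abs_quadForm_sub_le_of_entry hE x).trans ?_
  have e : ∑ i, ∑ j, (of fun i j => a * (Real.sqrt (M i i) * Real.sqrt (M j j)) + b) i j *
      |x i| * |x j| = a * (∑ i, Real.sqrt (M i i) * |x i|) ^ 2 + b * (∑ i, |x i|) ^ 2 := by
    rw [← sum_sum_mul_eq_sq, ← sum_sum_mul_eq_sq, Finset.mul_sum, Finset.mul_sum,
      ← Finset.sum_add_distrib]
    refine Finset.sum_congr rfl fun i _ => ?_
    rw [Finset.mul_sum, Finset.mul_sum, ← Finset.sum_add_distrib]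
    exact Finset.sum_congr rfl fun j _ => by rw [of_apply]; ring
  rw [e]
  have h2 : (∑ i, |x i|) ^ 2 ≤ n * (x ⬝ᵥ x) := by
    have := sq_sum_le_card_mul_sum_sq (s := Finset.univ) (f := fun i => |x i|)
    simpa [sq_abs, dotProduct_self_eq_sum] using this
  exact add_le_add (mul_le_mul_of_nonneg_left
    (sum_sqrt_mul_abs_sq_le (fun i => (hM.diag_pos (i := i)).le) x) ha)
    (mul_le_mul_of_nonneg_left h2 hb)

/-- A small relative perturbation of the form changes the scaled condition number by a factor of
at most four. -/
lemma scaledCond_le_of_quadForm {A B : Matrix (Fin n) (Fin n) ℝ} (hn : 0 < n) (hA : A.PosDef)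
    (hB : B.PosDef) (h : ∀ x, |quadForm B x - quadForm A x| ≤ 1 / 3 * quadForm A x) :
    scaledCond B ≤ 4 * scaledCond A := by
  obtain ⟨l, L, hl, hL, -, hc, hb⟩ := exists_scaledCond_eq hn hA
  have hd : ∀ x, 2 / 3 * diagForm A x ≤ diagForm B x ∧ diagForm B x ≤ 4 / 3 * diagForm A x := by
    intro x
    have hi : ∀ i, 2 / 3 * A i i ≤ B i i ∧ B i i ≤ 4 / 3 * A i i := fun i => by
      have := abs_le.1 (h (Pi.single i 1))
      rw [quadForm_single, quadForm_single] at this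
      constructor <;> linarith [this.1, this.2]
    simp only [diagForm, Finset.mul_sum]
    constructor <;> refine Finset.sum_le_sum fun i _ => ?_
    · nlinarith [mul_le_mul_of_nonneg_right (hi i).1 (sq_nonneg (x i))]
    · nlinarith [mul_le_mul_of_nonneg_right (hi i).2 (sq_nonneg (x i))]
  have := scaledCond_le (l := l / 2) (L := 2 * L) hn hB (by linarith) fun x => by
    have h1 := abs_le.1 (h x)
    obtain ⟨h2, h3⟩ := hb x
    obtain ⟨h4, h5⟩ := hd x
    constructor
    · nlinarith [mul_le_mul_of_nonneg_left h5 hl.le]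
    · nlinarith [mul_le_mul_of_nonneg_left h4 (by linarith : 0 ≤ L)]
  rw [hc]
  refine this.trans (le_of_eq ?_)
  field_simp
  norm_num

/-! ### The nearly orthogonal congruence -/

lemma abs_mulVec_dotProduct_sub_le {Q : Matrix (Fin n) (Fin n) ℝ} {p : ℝ}
    (hQ : norm2 (Qᵀ * Q - 1) ≤ p) (x : Fin n → ℝ) :
    |(Q *ᵥ x) ⬝ᵥ (Q *ᵥ x) - x ⬝ᵥ x| ≤ p * (x ⬝ᵥ x) := by
  have e : (Q *ᵥ x) ⬝ᵥ (Q *ᵥ x) - x ⬝ᵥ x = x ⬝ᵥ (Qᵀ * Q - 1) *ᵥ x := by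
    rw [sub_mulVec, one_mulVec, dotProduct_sub, ← mulVec_mulVec, dotProduct_mulVec x Qᵀ,
      vecMul_transpose]
  have hx : x ⬝ᵥ x = ‖WithLp.toLp 2 x‖ ^ 2 := by
    rw [EuclideanSpace.norm_sq_eq, dotProduct_self_eq_sum]
    simp
  rw [e, hx]
  have := inner_toEuclideanCLM (Qᵀ * Q - 1) (WithLp.toLp 2 x) (WithLp.toLp 2 x)
  simp only at this
  rw [← this]
  refine (abs_real_inner_le_norm _ _).trans ?_
  have h2 := (toEuclideanCLM (n := Fin n) (𝕜 := ℝ) (Qᵀ * Q - 1)).le_opNorm (WithLp.toLp 2 x)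
  have h3 : ‖toEuclideanCLM (n := Fin n) (𝕜 := ℝ) (Qᵀ * Q - 1)‖ ≤ p := hQ
  have h4 := norm_nonneg (WithLp.toLp 2 x)
  calc _ ≤ ‖WithLp.toLp 2 x‖ * (p * ‖WithLp.toLp 2 x‖) := by
        refine mul_le_mul_of_nonneg_left (h2.trans ?_) h4
        exact mul_le_mul_of_nonneg_right h3 h4
    _ = _ := by ring

section
variable {A Q : Matrix (Fin n) (Fin n) ℝ} {p : ℝ} (hA : A.PosDef) (hp : p < 1)
  (hQ : ∀ x : Fin n → ℝ, |(Q *ᵥ x) ⬝ᵥ (Q *ᵥ x) - x ⬝ᵥ x| ≤ p * (x ⬝ᵥ x))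
include hp hQ

lemma mulVec_ne_zero_of_nearly_orthogonal {x : Fin n → ℝ} (hx : x ≠ 0) : Q *ᵥ x ≠ 0 := fun h => by
  have h1 := (abs_le.1 (hQ x)).1
  rw [h, dotProduct_zero] at h1
  nlinarith [dotProduct_self_pos hx]

include hA

lemma posDef_congruence : (Qᵀ * A * Q).PosDef := by
  obtain ⟨hs, hq⟩ := posDef_iff_quadForm.1 hA
  refine posDef_iff_quadForm.2 ⟨?_, fun x hx => ?_⟩
  · rw [IsSymm, transpose_mul, transpose_mul, transpose_transpose, hs, mul_assoc]
  · rw [quadForm_transpose_mul_mul]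
    exact hq _ (mulVec_ne_zero_of_nearly_orthogonal hp hQ hx)

/-- Ostrowski's theorem: a congruence with `‖QᵀQ - I‖ ≤ p` changes the eigenvalues by relative
errors of at most `p`. -/
theorem lam_congruence_bounds (k : Fin n) :
    (1 - p) * lam A k ≤ lam (Qᵀ * A * Q) k ∧ lam (Qᵀ * A * Q) k ≤ (1 + p) * lam A k := by
  have hB := posDef_congruence hA hp hQ
  have hsA := isOrderedSpectrum_lam (posDef_iff_quadForm.1 hA).1
  have hsB := isOrderedSpectrum_lam (posDef_iff_quadForm.1 hB).1
  constructor
  · have hdet : IsUnit Q.det := by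
      rw [isUnit_iff_ne_zero]
      intro h0
      obtain ⟨v, hv, hv0⟩ := exists_mulVec_eq_zero_iff.2 h0
      exact mulVec_ne_zero_of_nearly_orthogonal hp hQ hv hv0
    have hinv : ∀ x, Q *ᵥ (Q⁻¹ *ᵥ x) = x := fun x => by
      rw [mulVec_mulVec, mul_nonsing_inv _ hdet, one_mulVec]
    have := hsB.le_mul hsA (mulVecLin Q⁻¹) (μ := 1) (s := (1 - p)⁻¹) zero_le_one (fun x => ?_)
      (fun x => ?_) k (hsB.pos hB k).le
    · rw [one_mul, inv_mul_eq_div, le_div_iff₀ (by linarith)] at this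
      linarith
    · rw [quadForm_transpose_mul_mul, mulVecLin_apply, hinv, one_mul]
    · have h1 := (abs_le.1 (hQ (Q⁻¹ *ᵥ x))).1
      rw [hinv] at h1
      rw [mulVecLin_apply, inv_mul_eq_div, le_div_iff₀ (by linarith)]
      linarith
  · have := hsA.le_mul hsB (mulVecLin Q) (μ := 1) (s := 1 + p) zero_le_one (fun x => ?_)
      (fun x => ?_) k (hsA.pos hA k).le
    · rwa [one_mul] at this
    · rw [quadForm_transpose_mul_mul, mulVecLin_apply, one_mul]
    · rw [mulVecLin_apply]
      linarith [(abs_le.1 (hQ x)).2]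

end

/-! ### The computed preconditioned matrix -/

lemma isSymm_of_isComputedPrecond {fl flh : ℝ → ℝ} {A Q C : Matrix (Fin n) (Fin n) ℝ}
    (h : IsComputedPrecond fl flh A Q C) : C.IsSymm := by
  obtain ⟨P, B, -, -, ⟨hs, rfl⟩ | rfl⟩ := h
  exacts [hs, isSymm_flSymPart fl _]

/-- The bound on the high precision `uh` absorbs the condition number of `A`, so that the error of
the triple product is small relative to the smallest eigenvalue `l` of `A`. -/
lemma high_precision_error_le {u uh p l L δ : ℝ} (hn : 0 < n) (h0 : 0 ≤ uh) (hp : p < 1)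
    (hnu : 4 * n * uh ≤ 1) (hl : 0 < l) (hL : 0 < L) (hu : 0 ≤ u) (hδ : δ ≤ 4 * n * uh)
    (hg : gam n uh < u * (1 - p) / (16 * (n : ℝ) ^ (1 / 2 : ℝ) * (L / l))) :
    6 * n * δ * L ≤ 3 / 2 * n * u * ((1 - p) * l) := by
  have hn1 : (1 : ℝ) ≤ n := by exact_mod_cast hn
  have hs : (1 : ℝ) ≤ (n : ℝ) ^ (1 / 2 : ℝ) := Real.one_le_rpow hn1 (by norm_num)
  have h1 : n * uh ≤ gam n uh := by
    unfold gam
    rw [le_div_iff₀ (by linarith)]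
    have : 0 ≤ n * uh := by positivity
    nlinarith
  have h2 : u * (1 - p) / (16 * (n : ℝ) ^ (1 / 2 : ℝ) * (L / l)) ≤
      u * (1 - p) / (16 * (L / l)) := by
    have : 0 ≤ u * (1 - p) := mul_nonneg hu (by linarith)
    have : 16 * (L / l) ≤ 16 * (n : ℝ) ^ (1 / 2 : ℝ) * (L / l) := by
      have : 0 < L / l := by positivity
      nlinarith
    gcongr
  have h3 : n * uh * (16 * L) ≤ u * (1 - p) * l := by
    have h4 := h1.trans (hg.le.trans h2)
    rw [le_div_iff₀ (by positivity)] at h4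
    have h5 := mul_le_mul_of_nonneg_right h4 hl.le
    have e : n * uh * (16 * (L / l)) * l = n * uh * (16 * L) := by field_simp
    rwa [e] at h5
  calc 6 * n * δ * L ≤ 6 * n * (4 * n * uh) * L := by gcongr
    _ = 3 / 2 * n * (n * uh * (16 * L)) := by ring
    _ ≤ 3 / 2 * n * (u * (1 - p) * l) := by gcongr
    _ = _ := by ring

/-- The computed preconditioned matrix as a relative perturbation of the exact one. -/
theorem abs_quadForm_precond_sub_le (hn : 0 < n) {A Q C : Matrix (Fin n) (Fin n) ℝ}
    {u uh p : ℝ} {fl flh : ℝ → ℝ} (h0 : 0 ≤ uh) (huh : uh ≤ u) (hu : u ≤ 1 / 10)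
    (hnu : 4 * n * u ≤ 1) (hfl : IsRounding u fl) (hflh : IsRounding uh flh) (hA : A.PosDef)
    (hp : p < 1) (hQ : ∀ x : Fin n → ℝ, |(Q *ᵥ x) ⬝ᵥ (Q *ᵥ x) - x ⬝ᵥ x| ≤ p * (x ⬝ᵥ x))
    (hg : gam n uh < u * (1 - p) / (16 * (n : ℝ) ^ (1 / 2 : ℝ) * cond2 A))
    (hC : IsComputedPrecond fl flh A Q C) (x : Fin n → ℝ) :
    |quadForm C x - quadForm (Qᵀ * A * Q) x| ≤
      10 * (n ^ 2 * scaledCond (Qᵀ * A * Q) * u) * quadForm (Qᵀ * A * Q) x := by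
  have hu0 : 0 ≤ u := h0.trans huh
  have hn1 : (1 : ℝ) ≤ n := by exact_mod_cast hn
  have hM := posDef_congruence hA hp hQ
  obtain ⟨P, B, hP, hB, hCB⟩ := hC
  obtain ⟨l, L, hl, hc, hb⟩ := exists_cond2_eq hn hA
  obtain ⟨l', L', hl', hL', hl1, hc', hb'⟩ := exists_scaledCond_eq hn hM
  rw [hc] at hg
  have hAL := abs_entry_le hA fun x => (hb x).2
  have hL : 0 < L := (hA.diag_pos (i := ⟨0, hn⟩)).trans_le ((le_abs_self _).trans (hAL _ _))
  have hcol : ∀ i, ∑ k, Q k i ^ 2 ≤ 2 := fun i => by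
    have := (abs_le.1 (hQ (Pi.single i 1))).2
    rw [mulVec_single_one, dotProduct_self_eq_sum] at this
    simp at this
    linarith
  have hnuh : 4 * n * uh ≤ 1 := le_trans (by gcongr) hnu
  have huh1 : uh < 1 := by nlinarith
  have hδ := inv_one_sub_pow_le h0 hn hnuh
  have hent := abs_flTriple_sub_le (r := (1 - uh)⁻¹)
    ((one_le_inv₀ (by linarith)).2 (by linarith))
    (by
      rw [le_sub_iff_add_le, ← one_div, le_div_iff₀ (by linarith)]
      nlinarith)
    rfl (hδ.trans hnuh) hflh hP hB hAL hcol
  have herr := high_precision_error_le hn h0 hp hnuh hl hL hu0 hδ hg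
  have hf0 : 0 ≤ 3 / 2 * n * u * ((1 - p) * l) := by
    have : 0 < 1 - p := by linarith
    positivity
  have hdem := abs_demoted_sub_le hu0 hu hfl (posDef_iff_quadForm.1 hM).1
    (fun i j => (hent i j).trans herr) (hCB.imp And.right id)
  refine (abs_quadForm_sub_le_of_demoted hM (by positivity)
    (by linarith : 0 ≤ 3 * (3 / 2 * n * u * ((1 - p) * l))) hdem x).trans ?_
  have hq0 := quadForm_nonneg hM x
  have hκ : 1 / l' ≤ scaledCond (Qᵀ * A * Q) := by rw [hc']; gcongr
  have hκ1 : 1 ≤ scaledCond (Qᵀ * A * Q) := ((one_le_div hl').2 hl1).trans hκ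
  have hN : diagForm (Qᵀ * A * Q) x ≤ scaledCond (Qᵀ * A * Q) * quadForm (Qᵀ * A * Q) x := by
    refine le_trans ?_ (mul_le_mul_of_nonneg_right hκ hq0)
    rw [div_mul_eq_mul_div, one_mul, le_div_iff₀ hl', mul_comm]
    exact (hb' x).1
  have hX : (1 - p) * l * (x ⬝ᵥ x) ≤ quadForm (Qᵀ * A * Q) x := by
    rw [quadForm_transpose_mul_mul]
    have h1 := (hb (Q *ᵥ x)).1
    have h2 := (abs_le.1 (hQ x)).1
    nlinarith
  generalize quadForm (Qᵀ * A * Q) x = q at *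
  generalize scaledCond (Qᵀ * A * Q) = κ at *
  generalize diagForm (Qᵀ * A * Q) x = N at *
  have hnn : (n : ℝ) ≤ n ^ 2 := le_self_pow₀ hn1 two_ne_zero
  calc 4 * u * (n * N) + 3 * (3 / 2 * n * u * ((1 - p) * l)) * (n * (x ⬝ᵥ x))
      = 4 * u * (n * N) + 9 / 2 * (n ^ 2 * u * ((1 - p) * l * (x ⬝ᵥ x))) := by ring
    _ ≤ 4 * u * (n ^ 2 * (κ * q)) + 9 / 2 * (n ^ 2 * u * (κ * q)) := by
        have hX' := hX.trans (le_mul_of_one_le_left hq0 hκ1)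
        have hκq : 0 ≤ κ * q := mul_nonneg (by linarith) hq0
        have hnN : n * N ≤ n ^ 2 * (κ * q) :=
          (mul_le_mul_of_nonneg_left hN (Nat.cast_nonneg n)).trans
            (mul_le_mul_of_nonneg_right hnn hκq)
        exact add_le_add (mul_le_mul_of_nonneg_left hnN (by positivity))
          (mul_le_mul_of_nonneg_left (mul_le_mul_of_nonneg_left hX' (by positivity)) (by norm_num))
    _ ≤ 10 * (n ^ 2 * κ * u) * q := by
        have : 0 ≤ n ^ 2 * κ * u * q := by positivity
        nlinarith

/-! ### The complete run -/

/-- At most `S n²` rotations, each with the relative error `28800 g κ u`. -/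
lemma jacobiRun_factorClose {u g κ : ℝ} {S : ℕ} {fl : ℝ → ℝ} (h0 : 0 ≤ u) (hu : 80 * u ≤ 1)
    (hfl : IsRounding u fl) (hg : 1 ≤ g) (hn : 0 < n) {pivots : List (Fin n × Fin n)}
    (hp : ∀ p ∈ pivots, p.1 ≠ p.2) {H : Matrix (Fin n) (Fin n) ℝ} (hH : H.PosDef)
    (hκ : scaledCond H ≤ 4 * κ) (hκ0 : 0 ≤ κ) (hS : AtMostSweeps S pivots)
    (hgrow : GrowthAtMost fl H pivots g) (hw : 28800 * (S * g) * (n ^ 2 * κ * u) < 1) :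
    (jacobiIter fl H pivots).PosDef ∧
      FactorClose (1 - 28800 * (S * g) * (n ^ 2 * κ * u)) (lam H)
        (lam (jacobiIter fl H pivots)) := by
  have hn1 : (1 : ℝ) ≤ n := by exact_mod_cast hn
  have hlen : (pivots.length : ℝ) ≤ S * n ^ 2 := by
    have : pivots.length ≤ S * n ^ 2 := hS.trans (Nat.mul_le_mul_left _ (Nat.choose_le_pow n 2))
    exact_mod_cast this
  have hpos : ∀ {B : Matrix (Fin n) (Fin n) ℝ}, B.PosDef → ∀ k, 0 ≤ lam B k := fun hB k =>
    (lam_pos hB k).le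
  rcases pivots.length.eq_zero_or_pos with hz | hz
  · rw [List.length_eq_zero_iff] at hz
    subst hz
    refine ⟨hH, FactorClose.mono (σ := 1) ?_ (hpos hH) (hpos hH) fun k => by simp [jacobiIter]⟩
    have : 0 ≤ 28800 * (S * g) * (n ^ 2 * κ * u) := by positivity
    linarith
  · -- with at least one rotation, the error of a single one is below the total, hence below one
    have hM : 7200 * u * (g * (4 * κ)) * pivots.length ≤ 28800 * (S * g) * (n ^ 2 * κ * u) := by
      calc 7200 * u * (g * (4 * κ)) * pivots.length
          ≤ 7200 * u * (g * (4 * κ)) * (S * n ^ 2) := by gcongr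
        _ = _ := by ring
    have hη0 : 0 ≤ 7200 * u * (g * (4 * κ)) := by positivity
    have hη : 7200 * u * (g * (4 * κ)) < 1 := by
      have : (1 : ℝ) ≤ pivots.length := by exact_mod_cast hz
      nlinarith
    obtain ⟨h1, h2⟩ := jacobiIter_factorClose h0 hu hfl hη pivots hp hH fun m hm =>
      (hgrow m hm).trans (mul_le_mul_of_nonneg_left hκ (by linarith))
    refine ⟨h1, h2.mono ?_ (hpos hH) (hpos h1)⟩
    -- Bernoulli's inequality turns the product of the factors into a sum of relative errors
    have := one_add_mul_le_pow (a := -(7200 * u * (g * (4 * κ)))) (by linarith) pivots.length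
    rw [← sub_eq_add_neg] at this
    linarith

lemma one_sub_add_le_mul {a b d : ℝ} (ha : 0 ≤ a) (hb : 0 ≤ b) (hb1 : b ≤ 1)
    (hd : 0 ≤ d) : 1 - (a + b + d) ≤ (1 - a) * (1 - b) * (1 - d) := by
  have h1 : 1 - (a + b) ≤ (1 - a) * (1 - b) := by linarith [mul_nonneg ha hb]
  have h2 : (1 - a) * (1 - b) ≤ 1 := mul_le_one₀ (by linarith) (by linarith) (by linarith)
  linarith [mul_le_mul_of_nonneg_right h2 hd]

/-- A congruence error `p` and a relative error `T` of the computed eigenvalue combine without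
enlarging the coefficient of `p`. -/
lemma relative_error_le {l μ h p T : ℝ} (hp1 : p ≤ 1) (hp : 0 ≤ p) (hT : 0 ≤ T) (hT1 : T ≤ 1 / 2)
    (hl : 0 < l) (hμ : 0 < μ) (h1 : (1 - p) * l ≤ μ) (h2 : μ ≤ (1 + p) * l)
    (h3 : (1 - T) * μ ≤ h) (h4 : (1 - T) * h ≤ μ) : |h - l| / l ≤ 4 * T + p := by
  have hup : h ≤ (1 + 2 * T) * μ := by
    have h5 : μ ≤ (1 - T) * ((1 + 2 * T) * μ) := by
      have : 0 ≤ T * (1 - 2 * T) * μ := by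
        have : 0 ≤ 1 - 2 * T := by linarith
        positivity
      linarith
    exact le_of_mul_le_mul_left (h4.trans h5) (by linarith)
  rw [div_le_iff₀ hl, abs_le]
  have hTl : 0 ≤ T * l := by positivity
  have hpTl : 0 ≤ p * (T * l) := by positivity
  have hpTl' : p * (T * l) ≤ 1 * (T * l) := mul_le_mul_of_nonneg_right hp1 hTl
  constructor
  · linarith [mul_le_mul_of_nonneg_left h1 (by linarith : 0 ≤ 1 - T)]
  · linarith [mul_le_mul_of_nonneg_left h2 (by linarith : 0 ≤ 1 + 2 * T)]

end MixedJacobi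

theorem mainTheorem1 :
    ∃ q : ℝ[X], q.natDegree ≤ 2 ∧
      ∀ (c g : ℝ) (S : ℕ), 1 ≤ g →
      ∃ p₃ : ℝ[X], p₃ = Polynomial.C (1 + c + S * g) * q ∧ p₃.natDegree ≤ 2 ∧
      ∀ (n : ℕ) (A Q Acomp : Matrix (Fin n) (Fin n) ℝ) (u uh p₁ tol : ℝ) (fl flh : ℝ → ℝ)
        (pivots : List (Fin n × Fin n)),
        -- the two precisions
        0 < uh → uh < u → u < 0.1 → (n : ℝ) * u < 1 / 2 →
        MixedJacobi.IsRounding u fl → MixedJacobi.IsRounding uh flh →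
        -- the data
        A.PosDef →
        MixedJacobi.norm2 (Q.transpose * Q - 1) ≤ p₁ * u → p₁ * u < 1 →
        -- the three conditions relating precisions, dimension and condition numbers
        10 * (n : ℝ) ^ (3 / 2 : ℝ) * u * (1 - p₁ * u)⁻¹ * MixedJacobi.cond2 A < 1 →
        MixedJacobi.gam n uh <
          u * (1 - p₁ * u) / (16 * (n : ℝ) ^ (1 / 2 : ℝ) * MixedJacobi.cond2 A) →
        14 * n * u * MixedJacobi.scaledCond (Q.transpose * A * Q) < 1 →
        -- the algorithm
        MixedJacobi.IsComputedPrecond fl flh A Q Acomp →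
        0 < tol → tol ≤ c * u →
        MixedJacobi.IsJacobiRun fl tol Acomp pivots →
        MixedJacobi.AtMostSweeps S pivots →
        MixedJacobi.GrowthAtMost fl Acomp pivots g →
        -- both terms of the bound are less than one (`p₁ * u < 1` is required above)
        p₃.eval (n : ℝ) * MixedJacobi.scaledCond (Q.transpose * A * Q) * u < 1 →
        ∀ k : Fin n,
          |MixedJacobi.computedEig fl Acomp pivots k - MixedJacobi.lam A k| / MixedJacobi.lam A k ≤
            p₃.eval (n : ℝ) * MixedJacobi.scaledCond (Q.transpose * A * Q) * u + p₁ * u := by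
  have hdeg : (Polynomial.C (115200 : ℝ) * X ^ 2).natDegree ≤ 2 := natDegree_C_mul_X_pow_le _ _
  -- `115200 = 4 * 28800`: the rotations contribute `28800`, and `relative_error_le` a factor `4`
  refine ⟨Polynomial.C 115200 * X ^ 2, hdeg, fun c g S hg =>
    ⟨_, rfl, (natDegree_C_mul_le _ _).trans hdeg, ?_⟩⟩
  intro n A Q Acomp u uh p₁ tol fl flh pivots huh huhu hu1 _ hfl hflh hA hQ hp _ hgam _ hC htol
    htolc hrun hS hgrow hsmall k
  have hn : 0 < n := k.pos
  have hn1 : (1 : ℝ) ≤ n := by exact_mod_cast hn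
  have hu : 0 < u := huh.trans huhu
  have hc : 0 < c := pos_of_mul_pos_left (htol.trans_le htolc) hu.le
  have hQ' := MixedJacobi.abs_mulVec_dotProduct_sub_le hQ
  have hp0 : 0 ≤ p₁ * u := (norm_nonneg _).trans hQ
  have hM := MixedJacobi.posDef_congruence hA hp hQ'
  have hκ1 : 1 ≤ MixedJacobi.scaledCond (Q.transpose * A * Q) := by
    obtain ⟨l, L, hl, hL, hl1, hκ, -⟩ := MixedJacobi.exists_scaledCond_eq hn hM
    rw [hκ, one_le_div hl]
    linarith
  have hcongr := MixedJacobi.lam_congruence_bounds hA hp hQ' k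
  simp only [eval_mul, eval_C, eval_pow, eval_X] at hsmall ⊢
  set κ := MixedJacobi.scaledCond (Q.transpose * A * Q) with hκdef
  -- the small quantity in which all errors are measured
  set w := (n : ℝ) ^ 2 * κ * u with hw
  have ew : (1 + c + S * g) * (115200 * (n : ℝ) ^ 2) * κ * u = 115200 * ((1 + c + S * g) * w) := by
    rw [hw]; ring
  rw [ew] at hsmall ⊢
  have hnn : (n : ℝ) ≤ n ^ 2 := le_self_pow₀ hn1 two_ne_zero
  have hnuw : n * u ≤ w := by
    calc n * u ≤ n ^ 2 * u := by gcongr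
      _ ≤ n ^ 2 * u * κ := le_mul_of_one_le_right (by positivity) hκ1
      _ = w := by rw [hw]; ring
  have hw0 : 0 ≤ w := le_trans (by positivity) hnuw
  have huw : u ≤ w := (le_mul_of_one_le_left hu.le hn1).trans hnuw
  have hSg : 0 ≤ S * g := by positivity
  have hcw : 0 ≤ c * w := by positivity
  have hSgw : 0 ≤ S * g * w := by positivity
  have hexp : (1 + c + S * g) * w = w + c * w + S * g * w := by ring
  rw [hexp] at hsmall ⊢
  -- the computed preconditioned matrix
  have hform := MixedJacobi.abs_quadForm_precond_sub_le hn huh.le huhu.le (by linarith)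
    (by linarith) hfl hflh hA hp hQ' hgam hC
  rw [← hκdef, ← hw] at hform
  obtain ⟨hCpos, hF1⟩ := MixedJacobi.factorClose_of_quadForm hM
    (MixedJacobi.isSymm_of_isComputedPrecond hC)
    (MixedJacobi.isOrderedSpectrum_lam (MixedJacobi.posDef_iff_quadForm.1 hM).1)
    (MixedJacobi.isOrderedSpectrum_lam (MixedJacobi.isSymm_of_isComputedPrecond hC))
    LinearMap.id LinearMap.id (fun _ => rfl) (fun _ => rfl) (η := 10 * w) (by linarith) hform
  have hκC : MixedJacobi.scaledCond Acomp ≤ 4 * κ :=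
    MixedJacobi.scaledCond_le_of_quadForm hn hM hCpos fun x => (hform x).trans
      (mul_le_mul_of_nonneg_right (by linarith) (MixedJacobi.quadForm_nonneg hM x))
  -- the rotations
  obtain ⟨hHpos, hF2⟩ := MixedJacobi.jacobiRun_factorClose hu.le (by linarith) hfl hg hn hrun.1
    hCpos hκC (by linarith) hS hgrow (by linarith)
  -- the stopping criterion
  have hntol : n * tol ≤ c * w :=
    calc n * tol ≤ n * (c * u) := by gcongr
      _ = c * (n * u) := by ring
      _ ≤ c * w := by gcongr
  have hF3 := (MixedJacobi.stopCriterion_factorClose htol.le (by linarith) hHpos hrun.2).symm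
  have hF := ((hF1.trans (by linarith) (by linarith) hF2).trans
    (mul_nonneg (by linarith) (by linarith)) (by linarith) hF3) k
  have hprod := MixedJacobi.one_sub_add_le_mul (a := 10 * w) (b := 28800 * (S * g) * w)
    (d := n * tol) (by linarith) (by linarith) (by linarith) (by positivity)
  have hT : 10 * w + 28800 * (S * g) * w + n * tol ≤ 28800 * (w + c * w + S * g * w) := by
    linarith
  have hμ := MixedJacobi.lam_pos hM k
  have hρ : 0 ≤ (1 - 10 * w) * (1 - 28800 * (S * g) * w) * (1 - n * tol) :=
    mul_nonneg (mul_nonneg (by linarith) (by linarith)) (by linarith)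
  exact (MixedJacobi.relative_error_le hp.le hp0
    (T := 10 * w + 28800 * (S * g) * w + n * tol) (by positivity) (by linarith)
    (MixedJacobi.lam_pos hA k) hμ hcongr.1 hcongr.2
    ((mul_le_mul_of_nonneg_right hprod hμ.le).trans hF.1)
    ((mul_le_mul_of_nonneg_right hprod ((mul_nonneg hρ hμ.le).trans hF.1)).trans hF.2)).trans
    (by linarith)
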